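/- For a nonzero integer $k$ let $C_k : Y^2 = X^6 + k$. The \emph{reduced set} $\mathcal S(k)$ is the set of the following Diophantine equations in integers $x, y_1, y_2$ with $y_1y_2 \neq 0$, where $\delta_1,\delta_2$ range over the integers with $\delta_2 > 0$ and the stated product, and $\delta=\gcd(\delta_1,\delta_2)$: * if $k$ is odd and $\delta_1\delta_2=-k$, type I: $2x^3 = \delta_1 y_1^6 + \delta_2 y_2^6$ with $\gcd\left(\frac{\delta_1}{\delta} y_1, \frac{\delta_2}{\delta} y_2\right) = 1$ and $\gcd(2x, y_1y_2)=1$; * if $k$ is odd and $\delta_1\delta_2=-k$, type II: $x^3 = 16\delta_1 y_1^6 + \delta_2 y_2^6$ with $\gcd\left(\frac{2\delta_1}{\delta} y_1, \frac{\delta_2}{\delta} y_2\right) = 1$ and $\gcd(x, 2y_1y_2)=1$; * if $k\equiv 0 \pmod 4$ and $\delta_1\delta_2=-k/4$, type III: $x^3 = \delta_1 y_1^6 + \delta_2 y_2^6$ with $\gcd\left(\frac{\delta_1}{\delta} y_1, \frac{\delta_2}{\delta} y_2\right) = 1$ and $\gcd(x, y_1y_2)=1$; * if $k\equiv 2 \pmod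 4$ and $\delta_1\delta_2=-k/2$, type IV: $x^3 = 32\delta_1 y_1^6 + \delta_2 y_2^6$ with $\gcd\left(\frac{2\delta_1}{\delta} y_1, \frac{\delta_2}{\delta} y_2\right) = 1$ and $\gcd(x, 2y_1y_2)=1$. Let $k \in \{-43, -35, -21, 31, -972\}$. Then no equation in $\mathcal S(k)$ has a solution, and the curve $C_k$ has no finite rational point, that is, there are no $X, Y \in \mathbb{Q}$ with $Y^2 = X^6 + k$. (The case $k=-972$ is the theorem of Coombes and Grant that the only rational points of $y^2=x^6-972$ are the points at infinity.) -/

import Mathlib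

namespace Sextic

/-- The finite rational points of the curve `C_k : Y ^ 2 = X ^ 6 + k`, as pairs `(X, Y)`. -/
def finitePoints (k : ℤ) : Set (ℚ × ℚ) :=
  {P | P.2 ^ 2 = P.1 ^ 6 + (k : ℚ)}

/-- The four shapes of ternary equation to which `x ^ 6 + k * y ^ 6 = z ^ 2` is reduced. -/
inductive Kind
  | I
  | II
  | III
  | IV

/-- One equation of the reduced set: its shape and its two coefficients `δ₁`, `δ₂`. -/
structure Equation where
  kind : Kind
  δ₁ : ℤ
  δ₂ : ℤ

/-- The reduced set `S(k)`: types I and II for `k` odd, type III for `k ≡ 0 (mod 4)`,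
type IV for `k ≡ 2 (mod 4)`. Types I and III are symmetric in the two terms, so the same equation
may occur in it under two pairs of coefficients. -/
def reducedSet (k : ℤ) : Set Equation :=
  {e | 0 < e.δ₂ ∧
    match e.kind with
    | .I => k ≡ 1 [ZMOD 2] ∧ e.δ₁ * e.δ₂ = -k
    | .II => k ≡ 1 [ZMOD 2] ∧ e.δ₁ * e.δ₂ = -k
    | .III => k ≡ 0 [ZMOD 4] ∧ 4 * (e.δ₁ * e.δ₂) = -k
    | .IV => k ≡ 2 [ZMOD 4] ∧ 2 * (e.δ₁ * e.δ₂) = -k}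

/-- `(x, y₁, y₂)` is an integer solution of the equation `e`, with all the side conditions that
belong to its type. The divisions by `δ = gcd (δ₁, δ₂)` are exact. -/
def Equation.IsSolution (e : Equation) (x y₁ y₂ : ℤ) : Prop :=
  let δ : ℤ := Int.gcd e.δ₁ e.δ₂
  y₁ * y₂ ≠ 0 ∧
    match e.kind with
    | .I => 2 * x ^ 3 = e.δ₁ * y₁ ^ 6 + e.δ₂ * y₂ ^ 6 ∧
        Int.gcd (e.δ₁ / δ * y₁) (e.δ₂ / δ * y₂) = 1 ∧ Int.gcd (2 * x) (y₁ * y₂) = 1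
    | .II => x ^ 3 = 16 * e.δ₁ * y₁ ^ 6 + e.δ₂ * y₂ ^ 6 ∧
        Int.gcd (2 * e.δ₁ / δ * y₁) (e.δ₂ / δ * y₂) = 1 ∧ Int.gcd x (2 * y₁ * y₂) = 1
    | .III => x ^ 3 = e.δ₁ * y₁ ^ 6 + e.δ₂ * y₂ ^ 6 ∧
        Int.gcd (e.δ₁ / δ * y₁) (e.δ₂ / δ * y₂) = 1 ∧ Int.gcd x (y₁ * y₂) = 1
    | .IV => x ^ 3 = 32 * e.δ₁ * y₁ ^ 6 + e.δ₂ * y₂ ^ 6 ∧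
        Int.gcd (2 * e.δ₁ / δ * y₁) (e.δ₂ / δ * y₂) = 1 ∧ Int.gcd x (2 * y₁ * y₂) = 1

/-- The equation has no solution. -/
def Equation.Impossible (e : Equation) : Prop :=
  ∀ x y₁ y₂ : ℤ, ¬ e.IsSolution x y₁ y₂

end Sextic

/-!
A rational point on `Y ^ 2 = X ^ 6 + k` is a coprime pair `(x, y)` with
`z ^ 2 = x ^ 6 + k * y ^ 6`. The factors of `(z - x ^ 3) * (z + x ^ 3) = k * y ^ 6` are coprime
after removing the evident power of `2`, hence sixth powers up to complementary divisors of `k`,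
and their difference gives a solution of an equation of the reduced set. So only those equations
have to be treated.

Almost all of them are impossible modulo `8`, `7`, `9` or `13`, or at the prime `3`. What is left
are the equations with the trivial solution `y₁ = 0` (or `y₂ = 0`), which no congruence can
exclude: `x ^ 3 = 16 * c * y₁ ^ 6 + y₂ ^ 6` with `c = -k`, for `k` odd, and
`x ^ 3 = y₁ ^ 6 + 243 * y₂ ^ 6` (with `c = 3` below) for `k = -972`. For `k = 31` the case
`3 ∤ y₁` is excluded separately (`no_solution_of_not_three_dvd`); otherwise write `p` for the
variable with coefficient `1`. For odd `k` the other variable is then divisible by `3`. Factoring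
`x ^ 3 - (p ^ 2) ^ 3` and putting `x - p ^ 2 = 3 * h` one finds `h = c * t ^ 2`, with `t` a cube
up to powers of `2` and `3`, and
`p ^ 4 + 3 * c * p ^ 2 * t ^ 2 + 3 * c ^ 2 * t ^ 4 = (B ^ 3) ^ 2`. This is a `2`-covering of the
elliptic curve `Y ^ 2 = X ^ 3 - c ^ 3`, whose `2`-isogeny descent is carried out in
`no_solution_of_descent`. The first half (`exists_of_quartic_eq_sq`) gives coprime `R`, `S` with
`R * S = c * (t / 2) ^ 2`, `B ^ 3 = S ^ 2 + 3 * R ^ 2` and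
`p ^ 2 = S ^ 2 - 6 * R * S - 3 * R ^ 2`; the second half (`exists_of_quadratic_eq_sq`) gives
coprime `U`, `V` with `U * V = R` and `S = V ^ 2 + 3 * U * V + 3 * U ^ 2`. Descent on the elliptic
curve alone would leave twists by divisors `f` of `c`. Here `B ^ 3` is a cube and `S`, `V` are
sixth powers up to such an `f`, and this forces `f ≡ ±1` modulo `9` (`twist_of_quartic_eq_one`,
`twist_of_quadratic_eq_one`), which for the `c` in question leaves only `f = 1`, and `f = 35` for
`c = 35`, which is impossible modulo `5`. With `f = 1` one has `S = b ^ 6`, `V = v ^ 6` and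
`U = c * s ^ 2`, so that
`(v ^ 3) ^ 4 + 3 * c * (v ^ 3) ^ 2 * s ^ 2 + 3 * c ^ 2 * s ^ 4 = (b ^ 3) ^ 2` is an equation of
the original shape with `s` a proper divisor of `t`: infinite descent.
-/

namespace Sextic

/-! ### Coprime factorizations -/

theorem isCoprime_of_no_common_prime {a b : ℤ}
    (h : ∀ q : ℤ, Prime q → q ∣ a → q ∣ b → False) : IsCoprime a b := by
  rw [Int.isCoprime_iff_gcd_eq_one]
  by_contra hg
  obtain ⟨q, hq, hqd⟩ := Nat.exists_prime_and_dvd hg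
  have hd : (q : ℤ) ∣ (Int.gcd a b : ℤ) := by exact_mod_cast hqd
  exact h q (Nat.prime_iff_prime_int.mp hq) (hd.trans (Int.gcd_dvd_left ..))
    (hd.trans (Int.gcd_dvd_right ..))

theorem exists_mul_pow_six_of_coprime_nat {m n K A : ℕ} (hK : K ≠ 0) (hmn : m.Coprime n)
    (h : m * n = K * A ^ 6) :
    ∃ e f a b : ℕ, e * f = K ∧ a * b = A ∧ m = e * a ^ 6 ∧ n = f * b ^ 6 := by
  have hef : K.gcd m * K.gcd n = K := by
    rw [← Nat.Coprime.gcd_mul K hmn, h]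
    exact Nat.gcd_eq_left (dvd_mul_right ..)
  obtain ⟨m', hm'⟩ := Nat.gcd_dvd_right K m
  obtain ⟨n', hn'⟩ := Nat.gcd_dvd_right K n
  have hprod : m' * n' = A ^ 6 := by
    apply Nat.eq_of_mul_eq_mul_left (Nat.pos_of_ne_zero hK)
    calc K * (m' * n') = (K.gcd m * K.gcd n) * (m' * n') := by rw [hef]
      _ = (K.gcd m * m') * (K.gcd n * n') := by ring
      _ = K * A ^ 6 := by rw [← hm', ← hn', h]
  have hcop : m'.Coprime n' :=
    Nat.Coprime.of_dvd (Dvd.intro_left _ hm'.symm) (Dvd.intro_left _ hn'.symm) hmn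
  obtain ⟨a, ha⟩ := exists_eq_pow_of_mul_eq_pow (Nat.isUnit_iff.mpr hcop) hprod
  obtain ⟨b, hb⟩ := exists_eq_pow_of_mul_eq_pow (Nat.isUnit_iff.mpr hcop.symm)
    ((mul_comm n' m').trans hprod)
  refine ⟨_, _, a, b, hef, ?_, by rw [← ha]; exact hm', by rw [← hb]; exact hn'⟩
  apply Nat.pow_left_injective (n := 6) (by norm_num)
  simp only [mul_pow, ← ha, ← hb, hprod]

/-- Two coprime integers whose product is `K` times a nonzero sixth power are sixth powers up to
complementary factors of `K`. -/
theorem exists_mul_pow_six_of_isCoprime {r s K A : ℤ} (hK : K ≠ 0) (hA : A ≠ 0)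
    (hrs : IsCoprime r s) (h : r * s = K * A ^ 6) :
    ∃ e f a b : ℤ, e * f = K ∧ a * b = A ∧ r = e * a ^ 6 ∧ s = f * b ^ 6 := by
  obtain ⟨e, f, a, b, hef, hab, hr, hs⟩ := exists_mul_pow_six_of_coprime_nat
    (m := r.natAbs) (n := s.natAbs) (K := K.natAbs) (A := A.natAbs) (by simpa using hK)
    (Int.isCoprime_iff_gcd_eq_one.mp hrs)
    (by rw [← Int.natAbs_mul, h]; simp [Int.natAbs_mul, Int.natAbs_pow])
  have hsgn : r.sign * s.sign = K.sign := by
    rw [← Int.sign_mul, h, Int.sign_mul, Int.sign_eq_one_of_pos (a := A ^ 6) (by positivity),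
      mul_one]
  refine ⟨r.sign * e, s.sign * f, A.sign * a, b, ?_, ?_, ?_, ?_⟩
  · calc r.sign * e * (s.sign * f) = (r.sign * s.sign) * ((e * f : ℕ) : ℤ) := by push_cast; ring
      _ = K := by rw [hsgn, hef, Int.sign_mul_natAbs]
  · calc A.sign * a * b = A.sign * ((a * b : ℕ) : ℤ) := by push_cast; ring
      _ = A := by rw [hab, Int.sign_mul_natAbs]
  · have hA6 : A.sign ^ 6 = 1 := by
      rcases lt_or_gt_of_ne hA with h | h
      · rw [Int.sign_eq_neg_one_of_neg h]; norm_num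
      · rw [Int.sign_eq_one_of_pos h]; norm_num
    calc r = r.sign * (r.natAbs : ℤ) := (Int.sign_mul_natAbs r).symm
      _ = _ := by rw [hr]; push_cast; rw [mul_pow, hA6]; ring
  · calc s = s.sign * (s.natAbs : ℤ) := (Int.sign_mul_natAbs s).symm
      _ = _ := by rw [hs]; push_cast; ring

theorem exists_sq_of_pos_of_isCoprime {X Y Z : ℤ} (hX : 0 < X) (hY : 0 < Y)
    (hXY : IsCoprime X Y) (h : X * Y = Z ^ 2) : ∃ a b, a * b = Z ∧ X = a ^ 2 ∧ Y = b ^ 2 := by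
  obtain ⟨a, ha⟩ := Int.sq_of_isCoprime hXY h
  obtain ⟨b, hb⟩ := Int.sq_of_isCoprime hXY.symm ((mul_comm Y X).trans h)
  have ha' : X = a ^ 2 := ha.resolve_right fun h => by nlinarith [sq_nonneg a]
  have hb' : Y = b ^ 2 := hb.resolve_right fun h => by nlinarith [sq_nonneg b]
  have : (a * b) ^ 2 = Z ^ 2 := by rw [← h, ha', hb']; ring
  rcases sq_eq_sq_iff_eq_or_eq_neg.mp this with h | h
  · exact ⟨a, b, h, ha', hb'⟩
  · exact ⟨-a, b, by rw [neg_mul, h, neg_neg], by rw [neg_sq, ha'], hb'⟩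

/-- Positive coprime integers with product `3 * Z ^ 2` are a square and three times a square. -/
theorem exists_three_mul_sq_of_isCoprime {X Y Z : ℤ} (hX : 0 < X) (hY : 0 < Y)
    (hXY : IsCoprime X Y) (h : X * Y = 3 * Z ^ 2) :
    ∃ a b, a * b = Z ∧ ((X = 3 * a ^ 2 ∧ Y = b ^ 2) ∨ (X = a ^ 2 ∧ Y = 3 * b ^ 2)) := by
  rcases Int.prime_three.dvd_or_dvd (Dvd.intro _ h.symm) with ⟨X', rfl⟩ | ⟨Y', rfl⟩
  · obtain ⟨a, b, hab, rfl, rfl⟩ := exists_sq_of_pos_of_isCoprime (X := X') (Y := Y) (Z := Z)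
      (by linarith) hY hXY.of_mul_left_right (by linarith)
    exact ⟨a, b, hab, .inl ⟨rfl, rfl⟩⟩
  · obtain ⟨a, b, hab, rfl, rfl⟩ := exists_sq_of_pos_of_isCoprime (X := X) (Y := Y') (Z := Z)
      hX (by linarith) hXY.of_mul_right_right (by linarith)
    exact ⟨a, b, hab, .inr ⟨rfl, rfl⟩⟩

/-! ### Residues of powers -/

theorem pow_three_emod_three (n : ℤ) : n ^ 3 % 3 = n % 3 := by
  rcases (by omega : n % 3 = 0 ∨ n % 3 = 1 ∨ n % 3 = 2) with h | h | h <;>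
    simp [pow_succ, Int.mul_emod, h]

theorem odd_mul {a b : ℤ} (ha : a % 2 = 1) (hb : b % 2 = 1) : a * b % 2 = 1 := by
  simp [Int.mul_emod, ha, hb]

theorem pow_three_emod_seven (n : ℤ) : n ^ 3 % 7 = 0 ∨ n ^ 3 % 7 = 1 ∨ n ^ 3 % 7 = 6 := by
  rcases (by omega : n % 7 = 0 ∨ n % 7 = 1 ∨ n % 7 = 2 ∨ n % 7 = 3 ∨ n % 7 = 4 ∨ n % 7 = 5 ∨
    n % 7 = 6) with h | h | h | h | h | h | h <;> simp [pow_succ, Int.mul_emod, h]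

theorem pow_three_emod_nine (n : ℤ) : (n ^ 3 % 9 = 0 ∧ 3 ∣ n) ∨ n ^ 3 % 9 = 1 ∨ n ^ 3 % 9 = 8 := by
  rcases (by omega : n % 9 = 0 ∨ n % 9 = 1 ∨ n % 9 = 2 ∨ n % 9 = 3 ∨ n % 9 = 4 ∨ n % 9 = 5 ∨
    n % 9 = 6 ∨ n % 9 = 7 ∨ n % 9 = 8) with h | h | h | h | h | h | h | h | h <;>
    simp [pow_succ, Int.mul_emod, h] <;> omega

theorem pow_three_emod_thirteen (n : ℤ) :
    n ^ 3 % 13 = 0 ∨ n ^ 3 % 13 = 1 ∨ n ^ 3 % 13 = 5 ∨ n ^ 3 % 13 = 8 ∨ n ^ 3 % 13 = 12 := by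
  rcases (by omega : n % 13 = 0 ∨ n % 13 = 1 ∨ n % 13 = 2 ∨ n % 13 = 3 ∨ n % 13 = 4 ∨ n % 13 = 5 ∨
    n % 13 = 6 ∨ n % 13 = 7 ∨ n % 13 = 8 ∨ n % 13 = 9 ∨ n % 13 = 10 ∨ n % 13 = 11 ∨ n % 13 = 12)
    with h | h | h | h | h | h | h | h | h | h | h | h | h <;>
    simp [pow_succ, Int.mul_emod, h]

theorem pow_six_emod_seven (n : ℤ) : (n ^ 6 % 7 = 0 ∧ 7 ∣ n) ∨ n ^ 6 % 7 = 1 := by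
  rcases (by omega : n % 7 = 0 ∨ n % 7 = 1 ∨ n % 7 = 2 ∨ n % 7 = 3 ∨ n % 7 = 4 ∨ n % 7 = 5 ∨
    n % 7 = 6) with h | h | h | h | h | h | h <;> simp [pow_succ, Int.mul_emod, h]
  omega

theorem pow_six_emod_nine (n : ℤ) : (n ^ 6 % 9 = 0 ∧ 3 ∣ n) ∨ n ^ 6 % 9 = 1 := by
  rcases (by omega : n % 9 = 0 ∨ n % 9 = 1 ∨ n % 9 = 2 ∨ n % 9 = 3 ∨ n % 9 = 4 ∨ n % 9 = 5 ∨
    n % 9 = 6 ∨ n % 9 = 7 ∨ n % 9 = 8) with h | h | h | h | h | h | h | h | h <;>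
    simp [pow_succ, Int.mul_emod, h] <;> omega

theorem pow_six_emod_thirteen (n : ℤ) :
    (n ^ 6 % 13 = 0 ∧ 13 ∣ n) ∨ n ^ 6 % 13 = 1 ∨ n ^ 6 % 13 = 12 := by
  rcases (by omega : n % 13 = 0 ∨ n % 13 = 1 ∨ n % 13 = 2 ∨ n % 13 = 3 ∨ n % 13 = 4 ∨ n % 13 = 5 ∨
    n % 13 = 6 ∨ n % 13 = 7 ∨ n % 13 = 8 ∨ n % 13 = 9 ∨ n % 13 = 10 ∨ n % 13 = 11 ∨ n % 13 = 12)
    with h | h | h | h | h | h | h | h | h | h | h | h | h <;>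
    simp [pow_succ, Int.mul_emod, h]
  omega

theorem sq_emod_five (n : ℤ) : (n ^ 2 % 5 = 0 ∧ 5 ∣ n) ∨ n ^ 2 % 5 = 1 ∨ n ^ 2 % 5 = 4 := by
  rcases (by omega : n % 5 = 0 ∨ n % 5 = 1 ∨ n % 5 = 2 ∨ n % 5 = 3 ∨ n % 5 = 4)
    with h | h | h | h | h <;> simp [pow_succ, Int.mul_emod, h]
  omega

theorem sq_emod_nine (n : ℤ) :
    3 ∣ n ∨ (n ^ 2 % 9 = 1 ∧ (n % 9 = 1 ∨ n % 9 = 8)) ∨ n ^ 2 % 9 = 4 ∨ n ^ 2 % 9 = 7 := by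
  rcases (by omega : n % 3 = 0 ∨ n % 9 = 1 ∨ n % 9 = 2 ∨ n % 9 = 4 ∨ n % 9 = 5 ∨ n % 9 = 7 ∨
    n % 9 = 8) with h | h | h | h | h | h | h
  · exact .inl (by omega)
  all_goals right; simp [pow_succ, Int.mul_emod, h]

theorem sq_emod_three (n : ℤ) : (n ^ 2 % 3 = 0 ∧ 3 ∣ n) ∨ n ^ 2 % 3 = 1 := by
  rcases (by omega : n % 3 = 0 ∨ n % 3 = 1 ∨ n % 3 = 2) with h | h | h <;>
    simp [pow_succ, Int.mul_emod, h]
  omega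

theorem sq_emod_eight_of_odd {n : ℤ} (hn : n % 2 = 1) : n ^ 2 % 8 = 1 := by
  rcases (by omega : n % 8 = 1 ∨ n % 8 = 3 ∨ n % 8 = 5 ∨ n % 8 = 7) with h | h | h | h <;>
    simp [pow_succ, Int.mul_emod, h]

theorem pow_six_emod_eight_of_odd {n : ℤ} (hn : n % 2 = 1) : n ^ 6 % 8 = 1 := by
  rcases (by omega : n % 8 = 1 ∨ n % 8 = 3 ∨ n % 8 = 5 ∨ n % 8 = 7) with h | h | h | h <;>
    simp [pow_succ, Int.mul_emod, h]

theorem not_dvd_of_isCoprime {a b q : ℤ} (hq : Prime q) (h : IsCoprime a b) (ha : q ∣ a) :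
    ¬ q ∣ b :=
  fun hb => hq.not_isUnit (h.isUnit_of_dvd' ha hb)

theorem isCoprime_two_pow_of_odd {n : ℤ} (k : ℕ) (hn : n % 2 = 1) : IsCoprime (2 ^ k) n :=
  ((Int.prime_two.coprime_iff_not_dvd).mpr (by omega)).pow_left

theorem four_dvd_of_eight_dvd_sq {t : ℤ} (h8 : 8 ∣ t ^ 2) : 4 ∣ t := by
  rcases (by omega : 4 ∣ t ∨ t % 2 = 1 ∨ t % 8 = 2 ∨ t % 8 = 6) with h | h | h | h
  · exact h
  · have := sq_emod_eight_of_odd h; omega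
  all_goals
    have := Int.emod_eq_zero_of_dvd h8
    simp [sq, Int.mul_emod, h] at this

/-- If `4` divides `u * v` and `u` is odd, then `v` contributes nothing to `u ^ 2` and `v ^ 2`
modulo `8`. -/
theorem four_dvd_and_sq_emod_eight {u v : ℤ} (huv : 4 ∣ u * v) (hu : u % 2 = 1) :
    4 ∣ v ∧ u ^ 2 % 8 = 1 ∧ v ^ 2 % 8 = 0 := by
  obtain ⟨w, rfl⟩ : 4 ∣ v := (isCoprime_two_pow_of_odd 2 hu).dvd_of_dvd_mul_left huv
  have : (4 * w) ^ 2 = 8 * (2 * w ^ 2) := by ring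
  exact ⟨by omega, sq_emod_eight_of_odd hu, by omega⟩

/-! ### The two halves of the descent -/

/-- The first half of the descent: a point with `p` prime to `c * τ` on the quartic
`p ^ 4 + 12 * c * p ^ 2 * τ ^ 2 + 48 * c ^ 2 * τ ^ 4 = r ^ 2` comes from a point on
`p ^ 2 = S ^ 2 - 6 * R * S - 3 * R ^ 2`. The factors of `r ^ 2 - (p ^ 2 + 6 * c * τ ^ 2) ^ 2` are a
square and three times a square, and `p ^ 2 ≡ 1` modulo `8` tells which is which. -/
theorem exists_of_quartic_eq_sq {c p τ r : ℤ} (hr : 0 < r) (hc : c ≠ 0) (hτ : τ ≠ 0) (h2 : 2 ∣ τ)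
    (h3 : 3 ∣ τ) (hp : IsCoprime p (c * τ))
    (h : p ^ 4 + 12 * c * p ^ 2 * τ ^ 2 + 48 * c ^ 2 * τ ^ 4 = r ^ 2) :
    ∃ R S : ℤ, 0 < S ∧ R * S = c * τ ^ 2 ∧ IsCoprime R S ∧ r = S ^ 2 + 3 * R ^ 2 ∧
      p ^ 2 = S ^ 2 - 6 * R * S - 3 * R ^ 2 ∧ S % 2 = 1 ∧ ¬ 3 ∣ S := by
  have hpτ : IsCoprime p τ := hp.of_mul_right_right
  have hp2 : ¬ 2 ∣ p := not_dvd_of_isCoprime Int.prime_two hpτ.symm h2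
  have hp3 : ¬ 3 ∣ p := not_dvd_of_isCoprime Int.prime_three hpτ.symm h3
  have hp8 : p ^ 2 % 8 = 1 := sq_emod_eight_of_odd (by omega)
  obtain ⟨M, hM⟩ : ∃ M, M = p ^ 2 + 6 * c * τ ^ 2 := ⟨_, rfl⟩
  have hM8 : M % 8 = 1 := by
    obtain ⟨σ, rfl⟩ := h2
    have : 6 * c * (2 * σ) ^ 2 = 8 * (3 * c * σ ^ 2) := by ring
    omega
  have hrM : r ^ 2 = M ^ 2 + 12 * (c * τ ^ 2) ^ 2 := by rw [← h, hM]; ring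
  have hr2 : r % 2 = 1 := by
    by_contra hr2
    obtain ⟨s, rfl⟩ : 2 ∣ r := by omega
    have h1 : M ^ 2 % 8 = 1 := sq_emod_eight_of_odd (by omega)
    have h2 : (2 * s) ^ 2 = 2 * (2 * s ^ 2) := by ring
    omega
  obtain ⟨X, hX⟩ : ∃ X, r - M = 2 * X := ⟨(r - M) / 2, by omega⟩
  obtain ⟨Y, hY⟩ : ∃ Y, r + M = 2 * Y := ⟨(r + M) / 2, by omega⟩
  have hXYr : X + Y = r := by omega
  have hYXM : Y - X = M := by omega
  have hXY : X * Y = 3 * (c * τ ^ 2) ^ 2 := by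
    subst hXYr
    have : (X + Y) ^ 2 - (Y - X) ^ 2 = 4 * (X * Y) := by ring
    rw [hYXM] at this
    linarith
  have hcτ : c * τ ^ 2 ≠ 0 := mul_ne_zero hc (pow_ne_zero 2 hτ)
  have hXYpos : 0 < X * Y := by rw [hXY]; positivity
  have hXpos : 0 < X := by
    by_contra hX0
    have hY0 : Y < 0 := by nlinarith
    omega
  have hYpos : 0 < Y := by nlinarith
  have hcop : IsCoprime X Y := isCoprime_of_no_common_prime fun q hq hqX hqY => by
    have hqcτ : q ∣ c * τ := by
      have : q ∣ 3 * (c * τ ^ 2) ^ 2 := hXY ▸ dvd_mul_of_dvd_left hqX Y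
      rcases hq.dvd_or_dvd this with h | h
      · exact dvd_mul_of_dvd_right (h.trans h3) c
      · rcases hq.dvd_or_dvd (hq.dvd_of_dvd_pow h) with h | h
        · exact dvd_mul_of_dvd_left h τ
        · exact dvd_mul_of_dvd_right (hq.dvd_of_dvd_pow h) c
    have hqp : q ∣ p ^ 2 := by
      have h1 : q ∣ M := hYXM ▸ dvd_sub hqY hqX
      have h2 : q ∣ (c * τ) * (6 * τ) := dvd_mul_of_dvd_left hqcτ _
      have h3 : p ^ 2 = M - (c * τ) * (6 * τ) := by rw [hM]; ring
      exact h3 ▸ dvd_sub h1 h2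
    exact not_dvd_of_isCoprime hq hp (hq.dvd_of_dvd_pow hqp) hqcτ
  obtain ⟨a, b, hab, hcase⟩ := exists_three_mul_sq_of_isCoprime hXpos hYpos hcop hXY
  have hab4 : 4 ∣ a * b := by
    obtain ⟨σ, rfl⟩ := h2
    exact ⟨c * σ ^ 2, by rw [hab]; ring⟩
  -- One of `a`, `b` is odd and the other one divisible by `4`, so that `Y - X ≡ 1 (mod 8)`
  -- decides between the four shapes of `(X, Y)`.
  have hodd : ¬ (2 ∣ a ∧ 2 ∣ b) := by
    rintro ⟨ha, hb⟩
    have ha2 : 2 ∣ a ^ 2 := dvd_pow ha two_ne_zero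
    have hb2 : 2 ∣ b ^ 2 := dvd_pow hb two_ne_zero
    rcases hcase with ⟨h1, h2⟩ | ⟨h1, h2⟩ <;> omega
  have hba4 : 4 ∣ b * a := by rwa [mul_comm]
  obtain ⟨hX', hY'⟩ : X = 3 * a ^ 2 ∧ Y = b ^ 2 := by
    refine hcase.resolve_right ?_
    rintro ⟨h1, h2⟩
    by_cases ha : 2 ∣ a
    · have := four_dvd_and_sq_emod_eight hba4 (by omega)
      omega
    · have := four_dvd_and_sq_emod_eight hab4 (by omega)
      omega
  have hb2 : b % 2 = 1 := by
    by_contra hb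
    have := four_dvd_and_sq_emod_eight hab4 (by omega)
    omega
  have hb3 : ¬ 3 ∣ b := fun hb => not_dvd_of_isCoprime Int.prime_three hcop
    ⟨a ^ 2, hX'⟩ (hY' ▸ dvd_pow hb two_ne_zero)
  have hcop' : IsCoprime a b := by
    rw [hX', hY'] at hcop
    exact (IsCoprime.pow_iff two_pos two_pos).mp hcop.of_mul_left_right
  have hr' : r = b ^ 2 + 3 * a ^ 2 := by omega
  have hp' : p ^ 2 = b ^ 2 - 6 * (a * b) - 3 * a ^ 2 := by
    rw [hab]; linarith
  rcases lt_or_gt_of_ne (show b ≠ 0 by omega) with hb | hb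
  · exact ⟨-a, -b, by omega, by rw [neg_mul_neg, hab], hcop'.neg_neg, by rw [hr']; ring,
      by rw [hp']; ring, by omega, by rwa [dvd_neg]⟩
  · exact ⟨a, b, hb, hab, hcop', hr', by rw [hp']; ring, hb2, hb3⟩

/-- The second half of the descent: a point on `p ^ 2 = S ^ 2 - 6 * R * S - 3 * R ^ 2` comes from
a point on `S = V ^ 2 + 3 * U * V + 3 * U ^ 2`, by factoring `(S - 3 * R) ^ 2 - p ^ 2`. -/
theorem exists_of_quadratic_eq_sq {p R S : ℤ} (hR : R ≠ 0) (h4 : 4 ∣ R) (h3 : 3 ∣ R)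
    (hpR : IsCoprime p R) (hS8 : S % 8 = 1) (hS3 : S % 3 = 1)
    (h : p ^ 2 = S ^ 2 - 6 * R * S - 3 * R ^ 2) :
    ∃ U V : ℤ, 0 < V ∧ U * V = R ∧ IsCoprime U V ∧ S = V ^ 2 + 3 * U * V + 3 * U ^ 2 ∧
      8 ∣ U ∧ V % 2 = 1 ∧ ¬ 3 ∣ V := by
  have hp2 : ¬ 2 ∣ p := not_dvd_of_isCoprime Int.prime_two hpR.symm (by omega)
  obtain ⟨X, hX⟩ : ∃ X, S - 3 * R - p = 2 * X := ⟨(S - 3 * R - p) / 2, by omega⟩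
  obtain ⟨Y, hY⟩ : ∃ Y, S - 3 * R + p = 2 * Y := ⟨(S - 3 * R + p) / 2, by omega⟩
  have hsum : X + Y = S - 3 * R := by omega
  have hdiff : Y - X = p := by omega
  have hXY : X * Y = 3 * R ^ 2 := by
    have h1 : (X + Y) ^ 2 - (Y - X) ^ 2 = 4 * (X * Y) := by ring
    rw [hsum, hdiff, h] at h1
    linarith
  have hcop : IsCoprime X Y := isCoprime_of_no_common_prime fun q hq hqX hqY => by
    have hqR : q ∣ R := by
      have : q ∣ 3 * R ^ 2 := hXY ▸ dvd_mul_of_dvd_left hqX Y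
      rcases hq.dvd_or_dvd this with h | h
      · exact h.trans h3
      · exact hq.dvd_of_dvd_pow h
    exact not_dvd_of_isCoprime hq hpR (hdiff ▸ dvd_sub hqY hqX) hqR
  have hXYpos : 0 < X * Y := by rw [hXY]; positivity
  have main : ∃ U V : ℤ, U * V = R ∧ IsCoprime U V ∧
      (S = V ^ 2 + 3 * U * V + 3 * U ^ 2 ∨ S = 3 * (U * V) - (V ^ 2 + 3 * U ^ 2)) := by
    have shape : ∀ X Y : ℤ, 0 < X → 0 < Y → IsCoprime X Y → X * Y = 3 * R ^ 2 →
        ∃ U V : ℤ, U * V = R ∧ IsCoprime U V ∧ X + Y = V ^ 2 + 3 * U ^ 2 := by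
      intro X Y hX hY hcop hXY
      obtain ⟨a, b, hab, ⟨rfl, rfl⟩ | ⟨rfl, rfl⟩⟩ :=
        exists_three_mul_sq_of_isCoprime hX hY hcop hXY
      · exact ⟨a, b, hab, (IsCoprime.pow_iff two_pos two_pos).mp hcop.of_mul_left_right, by ring⟩
      · exact ⟨b, a, by rw [mul_comm, hab],
          ((IsCoprime.pow_iff two_pos two_pos).mp hcop.of_mul_right_right).symm, by ring⟩
    rcases lt_or_gt_of_ne (show X ≠ 0 by rintro rfl; simp at hXYpos) with hX0 | hX0
    · obtain ⟨U, V, hUV, hc, hs⟩ := shape (-X) (-Y) (by omega) (by nlinarith) hcop.neg_neg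
        (by rw [neg_mul_neg, hXY])
      exact ⟨U, V, hUV, hc, .inr (by rw [hUV, ← hs]; linarith)⟩
    · obtain ⟨U, V, hUV, hc, hs⟩ := shape X Y hX0 (by nlinarith) hcop hXY
      exact ⟨U, V, hUV, hc, .inl (by rw [mul_assoc, hUV]; linarith)⟩
  obtain ⟨U, V, hUV, hcUV, hS⟩ := main
  have hUV4 : 4 ∣ U * V := hUV ▸ h4
  have hUV3 : 3 ∣ U * V := hUV ▸ h3
  have hS' : S = V ^ 2 + 3 * (U * V) + 3 * U ^ 2 := by
    refine (by simpa only [mul_assoc] using hS : _ ∨ _).resolve_right fun hS => ?_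
    -- Modulo `3` the other sign would make `-V ^ 2` congruent to `1`.
    rcases sq_emod_three V with ⟨hV, -⟩ | hV <;> omega
  have hV2 : V % 2 = 1 := by
    by_contra hV
    have hU : ¬ 2 ∣ U := fun hU => not_dvd_of_isCoprime Int.prime_two hcUV hU (by omega)
    have := four_dvd_and_sq_emod_eight hUV4 (by omega)
    omega
  have hU4 := four_dvd_and_sq_emod_eight (u := V) (v := U) (by rwa [mul_comm]) hV2
  have hU8 : 8 ∣ U := by
    have : 8 ∣ V * U := by rw [mul_comm]; omega
    exact (isCoprime_two_pow_of_odd 3 hV2).dvd_of_dvd_mul_left this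
  have hV3 : ¬ 3 ∣ V := fun hV => by
    have : 3 ∣ V ^ 2 := dvd_pow hV two_ne_zero
    omega
  rcases lt_or_gt_of_ne (show V ≠ 0 by omega) with hV | hV
  · exact ⟨-U, -V, by omega, by rw [neg_mul_neg, hUV], hcUV.neg_neg, by rw [hS']; ring,
      by rwa [dvd_neg], by omega, by rwa [dvd_neg]⟩
  · exact ⟨U, V, hV, hUV, hcUV, by rw [hS']; ring, hU8, hV2, hV3⟩

/-- A positive factor prime to `6` of a product `c * (2 ^ i * 3 ^ j) ^ 2 * A ^ 6` that is coprime
to its cofactor is a sixth power up to a divisor of `c`. -/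
theorem exists_factor_of_isCoprime {c A R S : ℤ} {i j : ℕ} (hc : c ≠ 0) (hA : A ≠ 0) (hS : 0 < S)
    (hS2 : S % 2 = 1) (hS3 : ¬ 3 ∣ S) (hRS : IsCoprime R S)
    (h : R * S = c * (2 ^ i * 3 ^ j) ^ 2 * A ^ 6) :
    ∃ e f a b : ℤ, 0 < f ∧ f ∣ c ∧ e * f = c * (2 ^ i * 3 ^ j) ^ 2 ∧ a * b = A ∧
      R = e * a ^ 6 ∧ S = f * b ^ 6 := by
  obtain ⟨e, f, a, b, hef, hab, hR, hS'⟩ := exists_mul_pow_six_of_isCoprime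
    (K := c * (2 ^ i * 3 ^ j) ^ 2) (mul_ne_zero hc (by positivity)) hA hRS h
  have hf2 : IsCoprime f 2 := ((Int.prime_two.coprime_iff_not_dvd).mpr fun h2 => by
    have : 2 ∣ S := hS' ▸ dvd_mul_of_dvd_left h2 _
    omega).symm
  have hf3 : IsCoprime f 3 := ((Int.prime_three.coprime_iff_not_dvd).mpr fun h3 =>
    hS3 (hS' ▸ dvd_mul_of_dvd_left h3 _)).symm
  refine ⟨e, f, a, b, ?_, ?_, hef, hab, hR, hS'⟩
  · exact pos_of_mul_pos_left (hS' ▸ hS) (by positivity)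
  · exact IsCoprime.dvd_of_dvd_mul_right ((hf2.pow_right.mul_right hf3.pow_right).pow_right)
      (Dvd.intro_left _ hef)

/-- No twist `f` occurs in the first half of the descent: modulo `9` it is `±1`, because
`B ^ 3 ≡ S ^ 2 ≡ f ^ 2`, and a factor `5` is impossible because `-3` is not a square modulo `5`. -/
theorem twist_of_quartic_eq_one {p R S B f b : ℤ} (hf : f % 9 = 1 ∨ f % 9 = 8 → f = 1 ∨ 5 ∣ f)
    (hRS : IsCoprime R S) (hS3 : ¬ 3 ∣ S) (h3R : 3 ∣ R) (hSf : S = f * b ^ 6)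
    (hB : B ^ 3 = S ^ 2 + 3 * R ^ 2) (hp : p ^ 2 = S ^ 2 - 6 * R * S - 3 * R ^ 2) : f = 1 := by
  have hf3 : ¬ 3 ∣ f := fun h => hS3 (hSf ▸ dvd_mul_of_dvd_left h _)
  have hb3 : ¬ 3 ∣ b := fun hb => hS3 (hSf ▸ dvd_mul_of_dvd_right (dvd_pow hb (by norm_num)) _)
  have hb9 : b ^ 6 % 9 = 1 := (pow_six_emod_nine b).resolve_left fun h => hb3 h.2
  have hf9 : f % 9 = 1 ∨ f % 9 = 8 := by
    have h1 : B ^ 3 % 9 = f ^ 2 % 9 := by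
      obtain ⟨R', rfl⟩ := h3R
      have h2 : (f * b ^ 6) ^ 2 % 9 = f ^ 2 % 9 := by
        rw [mul_pow, Int.mul_emod, sq (b ^ 6), Int.mul_emod (b ^ 6), hb9]; simp
      have h3 : 3 * (3 * R') ^ 2 = 9 * (3 * R' ^ 2) := by ring
      rw [hB, hSf, h3]; omega
    have h4 := pow_three_emod_nine B
    rcases sq_emod_nine f with h | h | h <;> omega
  refine (hf hf9).resolve_right fun h5 => ?_
  obtain ⟨s, hs⟩ : 5 ∣ S := hSf ▸ dvd_mul_of_dvd_left h5 _
  have h5R : ¬ 5 ∣ R := fun h => not_dvd_of_isCoprime (q := 5) (by norm_num) hRS h ⟨s, hs⟩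
  have h1 : p ^ 2 = 5 * (5 * s ^ 2 - 6 * R * s) - 3 * R ^ 2 := by rw [hp, hs]; ring
  rcases sq_emod_five p with h | h | h <;> rcases sq_emod_five R with h' | h' | h' <;> omega

/-- No twist `f` occurs in the second half of the descent, because `3` is not a square
modulo `5`. -/
theorem twist_of_quadratic_eq_one {U V f v b : ℤ} (hf : f % 9 = 1 ∨ f % 9 = 8 → f = 1 ∨ 5 ∣ f)
    (hUV : IsCoprime U V) (hV3 : ¬ 3 ∣ V) (h3U : 3 ∣ U) (hVf : V = f * v ^ 6) (hb3 : ¬ 3 ∣ b)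
    (hb : b ^ 6 = V ^ 2 + 3 * U * V + 3 * U ^ 2) : f = 1 := by
  have hv3 : ¬ 3 ∣ v := fun hv => hV3 (hVf ▸ dvd_mul_of_dvd_right (dvd_pow hv (by norm_num)) _)
  have hv9 : v ^ 6 % 9 = 1 := (pow_six_emod_nine v).resolve_left fun h => hv3 h.2
  have hb9 : b ^ 6 % 9 = 1 := (pow_six_emod_nine b).resolve_left fun h => hb3 h.2
  have hf9 : f % 9 = 1 ∨ f % 9 = 8 := by
    have h1 : f ^ 2 % 9 = 1 := by
      obtain ⟨U', rfl⟩ := h3U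
      have h2 : V ^ 2 % 9 = f ^ 2 % 9 := by
        rw [hVf, mul_pow, Int.mul_emod, sq (v ^ 6), Int.mul_emod (v ^ 6), hv9]; simp
      have h3 : b ^ 6 = V ^ 2 + 9 * (U' * V + 3 * U' ^ 2) := by rw [hb]; ring
      omega
    rcases sq_emod_nine f with h | h | h
    · exact absurd (hVf ▸ dvd_mul_of_dvd_left h _) hV3
    · exact h.2
    · omega
  refine (hf hf9).resolve_right fun h5 => ?_
  obtain ⟨s, hs⟩ : 5 ∣ V := hVf ▸ dvd_mul_of_dvd_left h5 _
  have h5U : ¬ 5 ∣ U := fun h => not_dvd_of_isCoprime (q := 5) (by norm_num) hUV h ⟨s, hs⟩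
  have h1 : (b ^ 3) ^ 2 = 5 * (5 * s ^ 2 + 3 * U * s) + 3 * U ^ 2 := by
    rw [← pow_mul, hb, hs]; ring
  rcases sq_emod_five (b ^ 3) with h | h | h <;> rcases sq_emod_five U with h' | h' | h' <;> omega

theorem natAbs_lt_of_dvd_half {s t τ : ℤ} (ht : t ≠ 0) (hτ : t = 2 * τ) (h : s ∣ τ) :
    s.natAbs < t.natAbs := by
  have := Int.natAbs_le_of_dvd_ne_zero h (by omega)
  omega

/-! ### Infinite descent -/

/-- The curve `p ^ 4 + 3 * c * p ^ 2 * t ^ 2 + 3 * c ^ 2 * t ^ 4 = r ^ 2`, with `r` a cube and `t` a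
cube up to a factor `2 ^ i * 3 ^ j`, has no nontrivial point with `t` divisible by `12`. The
hypothesis `hdiv` says that the divisors `f ≠ 1` of `c`, which might occur as twists in the descent,
are excluded modulo `9` or modulo `5`. -/
theorem no_solution_of_descent {c : ℤ} (hc2 : c % 2 = 1)
    (hdiv : ∀ f : ℤ, 0 < f → f ∣ c → f % 9 = 1 ∨ f % 9 = 8 → f = 1 ∨ 5 ∣ f) {j : ℕ} (hj : j ≠ 0)
    (n : ℕ) : ∀ (p t r A B : ℤ) (i : ℕ), t.natAbs = n → A ≠ 0 → t = 2 ^ i * 3 ^ j * A ^ 3 →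
      4 ∣ t → r = B ^ 3 → IsCoprime p (c * t) →
      p ^ 4 + 3 * c * p ^ 2 * t ^ 2 + 3 * c ^ 2 * t ^ 4 ≠ r ^ 2 := by
  induction n using Nat.strong_induction_on with
  | _ n ih =>
  intro p t r A B i hn hA ht h4 hr hp h
  have hc : c ≠ 0 := by omega
  have ht0 : t ≠ 0 := by rw [ht]; positivity
  have h3t : 3 ∣ t := by
    rw [ht]; exact dvd_mul_of_dvd_left (dvd_mul_of_dvd_right (dvd_pow_self 3 hj) _) _
  have hp2 : ¬ 2 ∣ p := not_dvd_of_isCoprime Int.prime_two hp.of_mul_right_right.symm (by omega)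
  have hr0 : r ≠ 0 := by
    rintro rfl
    have h1 : (p ^ 2) ^ 2 % 8 = 1 := sq_emod_eight_of_odd (by
      have := sq_emod_eight_of_odd (show p % 2 = 1 by omega); omega)
    obtain ⟨s, hs⟩ := h4
    have h2 : p ^ 4 + 3 * c * p ^ 2 * t ^ 2 + 3 * c ^ 2 * t ^ 4 =
      (p ^ 2) ^ 2 + 8 * (6 * c * p ^ 2 * s ^ 2 + 96 * c ^ 2 * s ^ 4) := by rw [hs]; ring
    omega
  wlog hrpos : 0 < r generalizing r B
  · exact this (-r) (-B) (by rw [hr]; ring) (by rw [h]; ring) (by omega) (by omega)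
  -- Extract a factor `2` from `t`, if necessary out of `A`.
  obtain ⟨i', A', hA', ht'⟩ : ∃ (i' : ℕ) (A' : ℤ), A' ≠ 0 ∧
      t = 2 * (2 ^ i' * 3 ^ j * A' ^ 3) := by
    rcases i with _ | i
    · have hA2 : 2 ∣ A := by
        have h2 : (2 : ℤ) ∣ 3 ^ j * A ^ 3 := by
          rw [pow_zero, one_mul] at ht; rw [← ht]; omega
        rcases Int.prime_two.dvd_or_dvd h2 with h2 | h2
        · have := Int.prime_two.dvd_of_dvd_pow h2; omega
        · exact Int.prime_two.dvd_of_dvd_pow h2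
      obtain ⟨A', rfl⟩ := hA2
      exact ⟨2, A', by omega, by rw [ht]; ring⟩
    · exact ⟨i, A, hA, by rw [ht]; ring⟩
  obtain ⟨τ, hτ⟩ : ∃ τ, τ = 2 ^ i' * 3 ^ j * A' ^ 3 := ⟨_, rfl⟩
  rw [← hτ] at ht'
  obtain ⟨R, S, hSpos, hRS, hcRS, hrRS, hpRS, hS2, hS3⟩ := exists_of_quartic_eq_sq (c := c) (p := p)
    (τ := τ) hrpos hc (by omega) (by omega) (by omega)
    (by rw [ht', mul_left_comm] at hp; exact hp.of_mul_right_right) (by rw [← h, ht']; ring)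
  have hτ2 : c * τ ^ 2 = c * (2 ^ i' * 3 ^ j) ^ 2 * A' ^ 6 := by rw [hτ]; ring
  obtain ⟨e, f, a, b, hf, hfc, hef, hab, hRe, hSf⟩ :=
    exists_factor_of_isCoprime hc hA' hSpos hS2 hS3 hcRS (hRS.trans hτ2)
  have hR0 : R ≠ 0 := by
    rintro rfl
    rw [zero_mul] at hRS
    exact mul_ne_zero hc (pow_ne_zero 2 (by omega)) hRS.symm
  have h3R : 3 ∣ R := by
    have : 3 ∣ R * S := by
      rw [hRS]; exact dvd_mul_of_dvd_right (dvd_pow (by omega) two_ne_zero) _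
    exact (Int.prime_three.dvd_or_dvd this).resolve_right hS3
  have h4R : 4 ∣ R := by
    have : 4 ∣ R * S := by
      obtain ⟨s, rfl⟩ : 2 ∣ τ := by omega
      exact ⟨c * s ^ 2, by rw [hRS]; ring⟩
    exact (isCoprime_two_pow_of_odd 2 hS2).dvd_of_dvd_mul_right this
  have hpR : IsCoprime p R := isCoprime_of_no_common_prime fun q hq hqp hqR => by
    have : q ∣ c * τ ^ 2 := hRS ▸ dvd_mul_of_dvd_left hqR S
    refine not_dvd_of_isCoprime hq hp hqp ?_
    rcases hq.dvd_or_dvd this with h | h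
    · exact dvd_mul_of_dvd_left h _
    · exact dvd_mul_of_dvd_right (ht' ▸ dvd_mul_of_dvd_right (hq.dvd_of_dvd_pow h) _) _
  have hb2 : b % 2 = 1 := by
    by_contra hb
    have : 2 ∣ S := hSf ▸ dvd_mul_of_dvd_right (dvd_pow (by omega) (by norm_num)) _
    omega
  have hb3 : ¬ 3 ∣ b := fun hb =>
    hS3 (hSf ▸ dvd_mul_of_dvd_right (dvd_pow hb (by norm_num)) _)
  have hb8 := pow_six_emod_eight_of_odd hb2
  have hb9 : b ^ 6 % 9 = 1 := (pow_six_emod_nine b).resolve_left fun h => hb3 h.2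
  obtain rfl : f = 1 :=
    twist_of_quartic_eq_one (hdiv f hf hfc) hcRS hS3 h3R hSf (hr.symm.trans hrRS) hpRS
  rw [one_mul] at hSf
  obtain ⟨U, V, hVpos, hUV, hcUV, hS, hU8, hV2, hV3⟩ := exists_of_quadratic_eq_sq hR0 h4R h3R hpR
    (by omega) (by omega) hpRS
  rw [mul_one] at hef
  have ha0 : a ≠ 0 := by rintro rfl; exact hA' (by rw [← hab, zero_mul])
  obtain ⟨e', f', u, v, hf', hfc', hef', huv, hUe, hVf⟩ :=
    exists_factor_of_isCoprime hc ha0 hVpos hV2 hV3 hcUV (by rw [hUV, hRe, hef])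
  have h3U : 3 ∣ U := (Int.prime_three.dvd_or_dvd (hUV ▸ h3R)).resolve_right hV3
  obtain rfl : f' = 1 :=
    twist_of_quadratic_eq_one (hdiv f' hf' hfc') hcUV hV3 h3U hVf hb3 (hSf ▸ hS)
  rw [one_mul] at hVf
  rw [mul_one] at hef'
  obtain ⟨t₁, ht₁⟩ : ∃ t₁, t₁ = 2 ^ i' * 3 ^ j * u ^ 3 := ⟨_, rfl⟩
  have hUt : U = c * t₁ ^ 2 := by rw [hUe, hef', ht₁]; ring
  have hu0 : u ≠ 0 := by rintro rfl; exact ha0 (by rw [← huv, zero_mul])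
  have ht₁0 : t₁ ≠ 0 := by rw [ht₁]; positivity
  have h4t₁ : 4 ∣ t₁ := four_dvd_of_eight_dvd_sq
    ((isCoprime_two_pow_of_odd 3 hc2).dvd_of_dvd_mul_left (hUt ▸ hU8))
  have ht₁τ : t₁ ∣ τ := by
    rw [ht₁, hτ]
    exact mul_dvd_mul_left _ (pow_dvd_pow_of_dvd
      ((Dvd.intro _ huv).trans (Dvd.intro _ hab)) 3)
  have hlt : t₁.natAbs < n := hn ▸ natAbs_lt_of_dvd_half ht0 ht' ht₁τ
  have hVv : V = (v ^ 3) ^ 2 := by rw [hVf]; ring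
  refine ih _ hlt (v ^ 3) t₁ (b ^ 3) u b i' rfl hu0 ht₁ h4t₁ rfl ?_ ?_
  · refine isCoprime_of_no_common_prime fun q hq hqv hqt => ?_
    refine not_dvd_of_isCoprime hq hcUV ?_ (hVv ▸ dvd_pow hqv two_ne_zero)
    rw [hUt, sq, ← mul_assoc]
    exact dvd_mul_of_dvd_left hqt _
  · calc (v ^ 3) ^ 4 + 3 * c * (v ^ 3) ^ 2 * t₁ ^ 2 + 3 * c ^ 2 * t₁ ^ 4
        = V ^ 2 + 3 * U * V + 3 * U ^ 2 := by rw [hUt, hVv]; ring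
      _ = (b ^ 3) ^ 2 := by rw [← hS, hSf]; ring

/-! ### Equations with the solution `y₁ = 0` -/

/-- If `h * (p ^ 4 + 3 * h * p ^ 2 + 3 * h ^ 2)` is `c * (2 ^ i * 3 ^ j) ^ 2` times a sixth power,
then the second factor is a sixth power up to a divisor of `c`. -/
theorem exists_factor_of_quartic {c p h y : ℤ} {i j : ℕ} (hc : c ≠ 0) (hp3 : ¬ 3 ∣ p)
    (hph : IsCoprime p h) (hy : y ≠ 0) (hN2 : (p ^ 4 + 3 * h * p ^ 2 + 3 * h ^ 2) % 2 = 1)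
    (heq : h * (p ^ 4 + 3 * h * p ^ 2 + 3 * h ^ 2) = c * (2 ^ i * 3 ^ j) ^ 2 * y ^ 6) :
    ∃ e f a b : ℤ, 0 < f ∧ f ∣ c ∧ e * f = c * (2 ^ i * 3 ^ j) ^ 2 ∧ a ≠ 0 ∧ b % 2 = 1 ∧
      h = e * a ^ 6 ∧ p ^ 4 + 3 * h * p ^ 2 + 3 * h ^ 2 = f * b ^ 6 := by
  obtain ⟨N, hN⟩ : ∃ N, N = p ^ 4 + 3 * h * p ^ 2 + 3 * h ^ 2 := ⟨_, rfl⟩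
  rw [← hN] at heq hN2 ⊢
  have hN3 : ¬ 3 ∣ N := fun h3 => hp3 <| by
    have h1 : p ^ 4 = N - 3 * (h * p ^ 2 + h ^ 2) := by rw [hN]; ring
    exact Int.prime_three.dvd_of_dvd_pow (h1 ▸ dvd_sub h3 (dvd_mul_right ..))
  have hNpos : 0 < N := by
    have h1 : 4 * N = (2 * p ^ 2 + 3 * h) ^ 2 + 3 * h ^ 2 := by rw [hN]; ring
    have := sq_nonneg (2 * p ^ 2 + 3 * h)
    have := sq_nonneg h
    omega
  have hhN : IsCoprime h N := isCoprime_of_no_common_prime fun q hq hqh hqN => by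
    refine not_dvd_of_isCoprime hq hph ?_ hqh
    have h1 : p ^ 4 = N - h * (3 * p ^ 2 + 3 * h) := by rw [hN]; ring
    exact hq.dvd_of_dvd_pow (h1 ▸ dvd_sub hqN (dvd_mul_of_dvd_left hqh _))
  obtain ⟨e, f, a, b, hf, hfc, hef, hab, hha, hNb⟩ :=
    exists_factor_of_isCoprime hc hy hNpos hN2 hN3 hhN heq
  refine ⟨e, f, a, b, hf, hfc, hef, ?_, ?_, hha, hNb⟩
  · rintro rfl; exact hy (by rw [← hab, zero_mul])
  · by_contra hb
    have : 2 ∣ N := hNb ▸ dvd_mul_of_dvd_right (dvd_pow (by omega) (by norm_num)) _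
    omega

/-- The equation `h * (p ^ 4 + 3 * h * p ^ 2 + 3 * h ^ 2) = c * (2 ^ i * 3 ^ j) ^ 2 * y ^ 6` leads
to the curve of `no_solution_of_descent` with `h = c * t ^ 2`, once the twists `f ≠ 1` are excluded
modulo `8`. -/
theorem no_solution_of_factors {c p h y : ℤ} {i j : ℕ} (hc2 : c % 2 = 1)
    (hdiv : ∀ f : ℤ, 0 < f → f ∣ c → f % 9 = 1 ∨ f % 9 = 8 → f = 1 ∨ 5 ∣ f) (hj : j ≠ 0)
    (hdiv8 : ∀ f : ℤ, 0 < f → f ∣ c → f % 8 = 1 → f = 1) (hp2 : p % 2 = 1) (hp3 : ¬ 3 ∣ p)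
    (hph : IsCoprime p h) (h8 : 8 ∣ h) (hy : y ≠ 0) :
    h * (p ^ 4 + 3 * h * p ^ 2 + 3 * h ^ 2) ≠ c * (2 ^ i * 3 ^ j) ^ 2 * y ^ 6 := by
  intro heq
  have hN8 : (p ^ 4 + 3 * h * p ^ 2 + 3 * h ^ 2) % 8 = 1 := by
    obtain ⟨g, rfl⟩ := h8
    have h1 : p ^ 4 + 3 * (8 * g) * p ^ 2 + 3 * (8 * g) ^ 2 =
      (p ^ 2) ^ 2 + 8 * (3 * g * p ^ 2 + 24 * g ^ 2) := by ring
    have h2 : (p ^ 2) ^ 2 % 8 = 1 :=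
      sq_emod_eight_of_odd (by have := sq_emod_eight_of_odd hp2; omega)
    omega
  obtain ⟨e, f, a, b, hf, hfc, hef, ha0, hb2, hha, hNb⟩ :=
    exists_factor_of_quartic (by omega) hp3 hph hy (by omega) heq
  obtain rfl : f = 1 := by
    refine hdiv8 f hf hfc ?_
    have h1 : f * b ^ 6 % 8 = f % 8 := by
      rw [Int.mul_emod, pow_six_emod_eight_of_odd hb2]; simp
    omega
  obtain ⟨t, ht⟩ : ∃ t, t = 2 ^ i * 3 ^ j * a ^ 3 := ⟨_, rfl⟩
  have hht : h = c * t ^ 2 := by rw [hha, ht, ← mul_one e, hef]; ring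
  refine no_solution_of_descent hc2 hdiv hj _ p t (b ^ 3) a b i rfl ha0 ht ?_ rfl ?_ ?_
  · exact four_dvd_of_eight_dvd_sq
      ((isCoprime_two_pow_of_odd 3 hc2).dvd_of_dvd_mul_left (hht ▸ h8))
  · refine isCoprime_of_no_common_prime fun q hq hqp hqt => not_dvd_of_isCoprime hq hph hqp ?_
    rw [hht, sq, ← mul_assoc]
    exact dvd_mul_of_dvd_left hqt _
  · rw [← pow_mul, ← one_mul (b ^ (3 * 2)), ← hNb, hht]; ring

/-- The equation of type II with coefficients `(c, 1)` has no solution with `y₁ = 3 * y`. -/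
theorem no_solution_of_three_dvd {c x y p : ℤ} (hc2 : c % 2 = 1)
    (hdiv : ∀ f : ℤ, 0 < f → f ∣ c → f % 9 = 1 ∨ f % 9 = 8 → f = 1 ∨ 5 ∣ f)
    (hdiv8 : ∀ f : ℤ, 0 < f → f ∣ c → f % 8 = 1 → f = 1) (hx2 : x % 2 = 1) (hp2 : p % 2 = 1)
    (hp3 : ¬ 3 ∣ p) (hxp : IsCoprime x p) (hy : y ≠ 0) :
    x ^ 3 ≠ 16 * c * (3 * y) ^ 6 + p ^ 6 := by
  intro heq
  obtain ⟨h, hh⟩ : ∃ h, x = p ^ 2 + 3 * h := by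
    have h1 := pow_three_emod_three x
    have h2 := pow_three_emod_three (p ^ 2)
    have h3 : x ^ 3 = 3 * (3888 * c * y ^ 6) + (p ^ 2) ^ 3 := by rw [heq]; ring
    exact ⟨(x - p ^ 2) / 3, by omega⟩
  have hphN : h * (p ^ 4 + 3 * h * p ^ 2 + 3 * h ^ 2) = c * (2 ^ 2 * 3 ^ 2) ^ 2 * y ^ 6 := by
    subst hh
    exact mul_left_cancel₀ (by norm_num : (9 : ℤ) ≠ 0) (by linear_combination heq)
  have hp8 := sq_emod_eight_of_odd hp2
  have h8 : 8 ∣ h := by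
    have hN : (p ^ 4 + 3 * h * p ^ 2 + 3 * h ^ 2) % 2 = 1 := by
      obtain ⟨g, rfl⟩ : 2 ∣ h := by omega
      have h1 : p ^ 4 + 3 * (2 * g) * p ^ 2 + 3 * (2 * g) ^ 2 =
        p ^ 2 * p ^ 2 + 2 * (3 * g * p ^ 2 + 6 * g ^ 2) := by ring
      have h2 := odd_mul (a := p ^ 2) (b := p ^ 2) (by omega) (by omega)
      omega
    refine (isCoprime_two_pow_of_odd 3 hN).dvd_of_dvd_mul_right ?_
    exact ⟨162 * c * y ^ 6, by rw [hphN]; ring⟩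
  refine no_solution_of_factors hc2 hdiv two_ne_zero hdiv8 hp2 hp3 ?_ h8 hy hphN
  refine isCoprime_of_no_common_prime fun q hq hqp hqh => not_dvd_of_isCoprime hq hxp ?_ hqp
  rw [hh]
  exact dvd_add (dvd_pow hqp two_ne_zero) (dvd_mul_of_dvd_right hqh 3)

/-- For `c = -31` the equation of type II with coefficients `(c, 1)` is not excluded modulo `9`
when `3 ∤ y`; then the cofactor `x ^ 2 + x * p ^ 2 + p ^ 4` of `x - p ^ 2` is congruent to `3`
modulo `8`, but it would have to be a sixth power or `31` times one. -/
theorem no_solution_of_not_three_dvd {x y p : ℤ} (hx2 : x % 2 = 1) (hp2 : p % 2 = 1)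
    (hxp : IsCoprime x p) (hy3 : ¬ 3 ∣ y) : x ^ 3 ≠ 16 * -31 * y ^ 6 + p ^ 6 := by
  intro heq
  obtain ⟨g, rfl⟩ : ∃ g, x = p ^ 2 + g := ⟨x - p ^ 2, by ring⟩
  have hy : y ≠ 0 := by rintro rfl; exact hy3 (dvd_zero 3)
  have hp8 := sq_emod_eight_of_odd hp2
  obtain ⟨N, hN⟩ : ∃ N, N = 3 * p ^ 4 + 3 * g * p ^ 2 + g ^ 2 := ⟨_, rfl⟩
  have hgN : g * N = -496 * y ^ 6 := by rw [hN]; linear_combination heq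
  have hy9 : y ^ 6 % 9 = 1 := (pow_six_emod_nine y).resolve_left fun h => hy3 h.2
  have hg3 : ¬ 3 ∣ g := by
    rintro ⟨m, rfl⟩
    have : 3 * m * N = 9 * (m * (p ^ 4 + 3 * m * p ^ 2 + 3 * m ^ 2)) := by rw [hN]; ring
    omega
  have hcop : IsCoprime g N := isCoprime_of_no_common_prime fun q hq hqg hqN => by
    have h1 : 3 * p ^ 4 = N - g * (3 * p ^ 2 + g) := by rw [hN]; ring
    have h2 : q ∣ 3 * p ^ 4 := h1 ▸ dvd_sub hqN (dvd_mul_of_dvd_left hqg _)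
    rcases hq.dvd_or_dvd h2 with h3 | h3
    · have : (3 : ℤ) ∣ q := (hq.associated_of_dvd Int.prime_three h3).symm.dvd
      exact hg3 (this.trans hqg)
    · have hqp := hq.dvd_of_dvd_pow h3
      exact not_dvd_of_isCoprime hq hxp (dvd_add (dvd_pow hqp two_ne_zero) hqg) hqp
  have hN2 : N % 2 = 1 := by
    obtain ⟨m, rfl⟩ : 2 ∣ g := by omega
    have h1 : N = 3 * (p ^ 2 * p ^ 2) + 2 * (3 * m * p ^ 2 + 2 * m ^ 2) := by rw [hN]; ring
    have h2 := odd_mul (a := p ^ 2) (b := p ^ 2) (by omega) (by omega)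
    omega
  have hN8 : N % 8 = 3 := by
    obtain ⟨m, rfl⟩ : 8 ∣ g := (isCoprime_two_pow_of_odd 3 hN2).dvd_of_dvd_mul_right (by omega)
    have h1 : N = 3 * (p ^ 2) ^ 2 + 8 * (3 * m * p ^ 2 + 8 * m ^ 2) := by rw [hN]; ring
    have h2 : (p ^ 2) ^ 2 % 8 = 1 := sq_emod_eight_of_odd (by omega)
    omega
  have hNpos : 0 < N := by
    have h1 : 4 * N = 3 * (2 * p ^ 2 + g) ^ 2 + g ^ 2 := by rw [hN]; ring
    have := sq_nonneg (2 * p ^ 2 + g)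
    have := sq_nonneg g
    omega
  obtain ⟨e, f, a, b, hef, -, -, hNb⟩ :=
    exists_mul_pow_six_of_isCoprime (by norm_num) hy hcop hgN
  have hb2 : b % 2 = 1 := by
    by_contra hb
    have : 2 ∣ N := hNb ▸ dvd_mul_of_dvd_right (dvd_pow (by omega) (by norm_num)) _
    omega
  have hf : f % 8 = 3 := by
    have h1 : f * b ^ 6 % 8 = f % 8 := by
      rw [Int.mul_emod, pow_six_emod_eight_of_odd hb2]; simp
    omega
  have hfpos : 0 < f := pos_of_mul_pos_left (hNb ▸ hNpos) (by positivity)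
  have hf31 : f ∣ 31 := by
    have h1 : f ∣ 2 ^ 4 * 31 := ⟨-e, by linarith⟩
    exact (isCoprime_two_pow_of_odd 4 (by omega)).symm.dvd_of_dvd_mul_left h1
  have hle := Int.le_of_dvd (by norm_num) hf31
  interval_cases f <;> omega

/-- The case `c = 3`, where the solution with `y = 0` lies on an equation of type III. -/
theorem no_solution_two_hundred_forty_three {x y p : ℤ} (hy : y ≠ 0) (hp : IsCoprime p (243 * y))
    (hxp : IsCoprime x p) : x ^ 3 ≠ p ^ 6 + 243 * y ^ 6 := by
  intro heq
  have hp3 : ¬ 3 ∣ p := fun h => not_dvd_of_isCoprime Int.prime_three hp h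
    (dvd_mul_of_dvd_left (by norm_num) _)
  obtain ⟨h, hh⟩ : ∃ h, x = p ^ 2 + 3 * h := by
    have h1 := pow_three_emod_three x
    have h2 := pow_three_emod_three (p ^ 2)
    have h3 : x ^ 3 = (p ^ 2) ^ 3 + 3 * (81 * y ^ 6) := by rw [heq]; ring
    exact ⟨(x - p ^ 2) / 3, by omega⟩
  have hphN : h * (p ^ 4 + 3 * h * p ^ 2 + 3 * h ^ 2) = 3 * (2 ^ 0 * 3 ^ 1) ^ 2 * y ^ 6 := by
    subst hh
    exact mul_left_cancel₀ (by norm_num : (9 : ℤ) ≠ 0) (by linear_combination heq)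
  have hph : IsCoprime p h := isCoprime_of_no_common_prime fun q hq hqp hqh => by
    refine not_dvd_of_isCoprime hq hxp ?_ hqp
    rw [hh]
    exact dvd_add (dvd_pow hqp two_ne_zero) (dvd_mul_of_dvd_right hqh 3)
  have hy2 : 2 ∣ y := by
    by_contra hy2
    have hy8 := pow_six_emod_eight_of_odd (n := y) (by omega)
    rcases Int.emod_two_eq_zero_or_one p with hp2 | hp2
    · -- Here the second factor is congruent to `3` modulo `4`, hence not a sixth power.
      obtain ⟨m, rfl⟩ : 2 ∣ p := by omega
      have hprod : h * ((2 * m) ^ 4 + 3 * h * (2 * m) ^ 2 + 3 * h ^ 2) % 2 = 1 := by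
        rw [hphN]; omega
      have hh2 : h % 2 = 1 := by
        by_contra h2
        have := (show (2 : ℤ) ∣ h by omega).mul_right
          ((2 * m) ^ 4 + 3 * h * (2 * m) ^ 2 + 3 * h ^ 2)
        omega
      have hh8 := sq_emod_eight_of_odd hh2
      have h4 : (2 * m) ^ 4 + 3 * h * (2 * m) ^ 2 + 3 * h ^ 2 =
        4 * (4 * m ^ 4 + 3 * h * m ^ 2) + 3 * h ^ 2 := by ring
      obtain ⟨e, f, a, b, hf, hfc, -, -, hb2, -, hNb⟩ :=
        exists_factor_of_quartic (by norm_num) hp3 hph hy (by omega) hphN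
      have hb8 := pow_six_emod_eight_of_odd hb2
      have hf3 : ¬ 3 ∣ f := fun h3 => hp3 <| by
        have h1 : (2 * m) ^ 4 = f * b ^ 6 - 3 * (h * (2 * m) ^ 2 + h ^ 2) := by rw [← hNb]; ring
        exact Int.prime_three.dvd_of_dvd_pow
          (h1 ▸ dvd_sub (dvd_mul_of_dvd_left h3 _) (dvd_mul_right ..))
      have hle := Int.le_of_dvd (by norm_num) hfc
      interval_cases f <;> omega
    · have hp8 := pow_six_emod_eight_of_odd hp2
      obtain ⟨m, rfl⟩ : 2 ∣ x := Int.prime_two.dvd_of_dvd_pow (n := 3) (by omega)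
      have : (2 * m) ^ 3 = 8 * m ^ 3 := by ring
      omega
  have hp2 : ¬ 2 ∣ p := fun h => not_dvd_of_isCoprime Int.prime_two hp h
    (dvd_mul_of_dvd_right hy2 _)
  have hp8 := sq_emod_eight_of_odd (n := p) (by omega)
  obtain ⟨m, rfl⟩ := hy2
  have hx3 : x ^ 3 % 2 = 1 := by
    have h1 : x ^ 3 = p ^ 6 + 2 * (243 * 32 * m ^ 6) := by rw [heq]; ring
    have h2 := pow_six_emod_eight_of_odd (n := p) (by omega)
    omega
  have hx2 : ¬ 2 ∣ x := fun h => by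
    have : 2 ∣ x ^ 3 := dvd_pow h (by norm_num)
    omega
  have hN2 : (p ^ 4 + 3 * h * p ^ 2 + 3 * h ^ 2) % 2 = 1 := by
    obtain ⟨g, rfl⟩ : 2 ∣ h := by omega
    have h1 : p ^ 4 + 3 * (2 * g) * p ^ 2 + 3 * (2 * g) ^ 2 =
      p ^ 2 * p ^ 2 + 2 * (3 * g * p ^ 2 + 6 * g ^ 2) := by ring
    have h2 := odd_mul (a := p ^ 2) (b := p ^ 2) (by omega) (by omega)
    omega
  have h8 : 8 ∣ h := by
    refine (isCoprime_two_pow_of_odd 3 hN2).dvd_of_dvd_mul_right ?_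
    exact ⟨27 * 8 * m ^ 6, by rw [hphN]; ring⟩
  refine no_solution_of_factors (by norm_num) ?_ one_ne_zero ?_ (by omega) hp3 hph h8 hy hphN
  all_goals
    intro f hf hfc h
    have hle := Int.le_of_dvd (by norm_num) hfc
    interval_cases f <;> omega

/-! ### Equations of the reduced set -/

theorem Equation.isSolution_I_iff {δ₁ δ₂ x y₁ y₂ : ℤ} (hδ : Int.gcd δ₁ δ₂ = 1) :
    (Equation.mk .I δ₁ δ₂).IsSolution x y₁ y₂ ↔ y₁ * y₂ ≠ 0 ∧
      2 * x ^ 3 = δ₁ * y₁ ^ 6 + δ₂ * y₂ ^ 6 ∧ IsCoprime (δ₁ * y₁) (δ₂ * y₂) ∧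
        IsCoprime (2 * x) (y₁ * y₂) := by
  simp [Equation.IsSolution, hδ, Int.isCoprime_iff_gcd_eq_one]

theorem Equation.isSolution_II_iff {δ₁ δ₂ x y₁ y₂ : ℤ} (hδ : Int.gcd δ₁ δ₂ = 1) :
    (Equation.mk .II δ₁ δ₂).IsSolution x y₁ y₂ ↔ y₁ * y₂ ≠ 0 ∧
      x ^ 3 = 16 * δ₁ * y₁ ^ 6 + δ₂ * y₂ ^ 6 ∧ IsCoprime (2 * δ₁ * y₁) (δ₂ * y₂) ∧
        IsCoprime x (2 * y₁ * y₂) := by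
  simp [Equation.IsSolution, hδ, Int.isCoprime_iff_gcd_eq_one]

theorem Equation.isSolution_III_iff {δ₁ δ₂ x y₁ y₂ : ℤ} (hδ : Int.gcd δ₁ δ₂ = 1) :
    (Equation.mk .III δ₁ δ₂).IsSolution x y₁ y₂ ↔ y₁ * y₂ ≠ 0 ∧
      x ^ 3 = δ₁ * y₁ ^ 6 + δ₂ * y₂ ^ 6 ∧ IsCoprime (δ₁ * y₁) (δ₂ * y₂) ∧
        IsCoprime x (y₁ * y₂) := by
  simp [Equation.IsSolution, hδ, Int.isCoprime_iff_gcd_eq_one]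

/-- Type II with coefficients `(c, 1)`, when the equation forces `3 ∣ y₁`. -/
theorem impossible_II_one {c : ℤ} (hc2 : c % 2 = 1)
    (hdiv : ∀ f : ℤ, 0 < f → f ∣ c → f % 9 = 1 ∨ f % 9 = 8 → f = 1 ∨ 5 ∣ f)
    (hdiv8 : ∀ f : ℤ, 0 < f → f ∣ c → f % 8 = 1 → f = 1)
    (h3 : ∀ x y p : ℤ, x % 2 = 1 → p % 2 = 1 → IsCoprime x p → x ^ 3 = 16 * c * y ^ 6 + p ^ 6 →
      3 ∣ y) : (Equation.mk .II c 1).Impossible := by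
  intro x y p hsol
  rw [Equation.isSolution_II_iff (by simp)] at hsol
  obtain ⟨h0, heq, hcop, hx⟩ := hsol
  rw [one_mul] at heq hcop
  have hx2 : ¬ 2 ∣ x := not_dvd_of_isCoprime Int.prime_two hx.symm
    (dvd_mul_of_dvd_left (dvd_mul_right ..) _)
  have hp2 : ¬ 2 ∣ p := not_dvd_of_isCoprime Int.prime_two hcop
    (dvd_mul_of_dvd_left (dvd_mul_right ..) _)
  have hxp : IsCoprime x p := hx.of_mul_right_right
  obtain ⟨y', rfl⟩ := h3 x y p (by omega) (by omega) hxp heq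
  have hp3 : ¬ 3 ∣ p := not_dvd_of_isCoprime Int.prime_three hcop
    (dvd_mul_of_dvd_right (dvd_mul_right ..) _)
  exact no_solution_of_three_dvd hc2 hdiv hdiv8 (by omega) (by omega) hp3 hxp
    (by rintro rfl; simp at h0) heq

/-- Type I is impossible modulo `8` if `δ₁ + δ₂ ≡ 4 (mod 8)`. -/
theorem impossible_I_of_add_emod_eight {δ₁ δ₂ : ℤ} (h : (δ₁ + δ₂) % 8 = 4)
    (hδ : Int.gcd δ₁ δ₂ = 1) : (Equation.mk .I δ₁ δ₂).Impossible := by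
  intro x y₁ y₂ hsol
  rw [Equation.isSolution_I_iff hδ] at hsol
  obtain ⟨-, heq, -, hx⟩ := hsol
  have h1 : ¬ 2 ∣ y₁ := fun h => not_dvd_of_isCoprime Int.prime_two hx (dvd_mul_right ..)
    (dvd_mul_of_dvd_left h _)
  have h2 : ¬ 2 ∣ y₂ := fun h => not_dvd_of_isCoprime Int.prime_two hx (dvd_mul_right ..)
    (dvd_mul_of_dvd_right h _)
  have h3 := pow_six_emod_eight_of_odd (n := y₁) (by omega)
  have h4 := pow_six_emod_eight_of_odd (n := y₂) (by omega)
  have h5 : (δ₁ * y₁ ^ 6) % 8 = δ₁ % 8 := by rw [Int.mul_emod, h3]; simp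
  have h6 : (δ₂ * y₂ ^ 6) % 8 = δ₂ % 8 := by rw [Int.mul_emod, h4]; simp
  obtain ⟨m, rfl⟩ : 2 ∣ x := Int.prime_two.dvd_of_dvd_pow (n := 3) (by omega)
  have : (2 * m) ^ 3 = 8 * m ^ 3 := by ring
  omega

/-- An equation of type I is impossible if it forces a prime to divide both `δ₁ * y₁` and
`δ₂ * y₂`. -/
theorem impossible_I_of_dvd {δ₁ δ₂ : ℤ} (q : ℤ) (hq : Prime q) (hδ : Int.gcd δ₁ δ₂ = 1)
    (h : ∀ x y₁ y₂ : ℤ, 2 * x ^ 3 = δ₁ * y₁ ^ 6 + δ₂ * y₂ ^ 6 → q ∣ δ₁ * y₁ ∧ q ∣ δ₂ * y₂) :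
    (Equation.mk .I δ₁ δ₂).Impossible := by
  intro x y₁ y₂ hsol
  rw [Equation.isSolution_I_iff hδ] at hsol
  have hd := h x y₁ y₂ hsol.2.1
  exact not_dvd_of_isCoprime hq hsol.2.2.1 hd.1 hd.2

/-- An equation of type II is impossible if it forces a prime to divide both `2 * δ₁ * y₁` and
`δ₂ * y₂`. -/
theorem impossible_II_of_dvd {δ₁ δ₂ : ℤ} (q : ℤ) (hq : Prime q) (hδ : Int.gcd δ₁ δ₂ = 1)
    (h : ∀ x y₁ y₂ : ℤ, x ^ 3 = 16 * δ₁ * y₁ ^ 6 + δ₂ * y₂ ^ 6 →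
      q ∣ 2 * δ₁ * y₁ ∧ q ∣ δ₂ * y₂) : (Equation.mk .II δ₁ δ₂).Impossible := by
  intro x y₁ y₂ hsol
  rw [Equation.isSolution_II_iff hδ] at hsol
  have hd := h x y₁ y₂ hsol.2.1
  exact not_dvd_of_isCoprime hq hsol.2.2.1 hd.1 hd.2

/-- An equation of type III is impossible if it forces `3` to divide both `x` and `y₁ * y₂`. -/
theorem impossible_III_of_dvd {δ₁ δ₂ : ℤ}
    (h : ∀ x y₁ y₂ : ℤ, x ^ 3 = δ₁ * y₁ ^ 6 + δ₂ * y₂ ^ 6 → 3 ∣ x ∧ 3 ∣ y₁ * y₂) :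
    (Equation.mk .III δ₁ δ₂).Impossible := by
  rintro x y₁ y₂ ⟨-, heq, -, hx⟩
  have hd := h x y₁ y₂ heq
  exact not_dvd_of_isCoprime Int.prime_three (Int.isCoprime_iff_gcd_eq_one.mpr hx) hd.1 hd.2

/-! ### The reduced sets -/

theorem impossible_of_mem_reducedSet_neg_forty_three :
    ∀ e ∈ reducedSet (-43), e.Impossible := by
  rintro ⟨kind, δ₁, δ₂⟩ ⟨hpos, h⟩
  have factors : δ₁ * δ₂ = 43 → (δ₁ = 43 ∧ δ₂ = 1) ∨ (δ₁ = 1 ∧ δ₂ = 43) := by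
    intro h
    have hle := Int.le_of_dvd (by norm_num) (Dvd.intro_left _ h)
    interval_cases δ₂ <;> omega
  rcases kind with _ | _ | _ | _
  · rcases factors h.2 with ⟨rfl, rfl⟩ | ⟨rfl, rfl⟩ <;>
      exact impossible_I_of_add_emod_eight (by norm_num) (by norm_num)
  · rcases factors h.2 with ⟨rfl, rfl⟩ | ⟨rfl, rfl⟩
    · apply impossible_II_one (by norm_num)
      · intro f hf hfc h
        have hle := Int.le_of_dvd (by norm_num) hfc
        interval_cases f <;> omega
      · intro f hf hfc h
        have hle := Int.le_of_dvd (by norm_num) hfc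
        interval_cases f <;> omega
      · intro x y p _ _ _ heq
        have := pow_three_emod_nine x
        have := pow_six_emod_nine y
        have := pow_six_emod_nine p
        omega
    · refine impossible_II_of_dvd 3 Int.prime_three (by norm_num) fun x y₁ y₂ heq => ?_
      have := pow_three_emod_nine x
      have := pow_six_emod_nine y₁
      have := pow_six_emod_nine y₂
      omega
  · exact absurd h.1 (by decide)
  · exact absurd h.1 (by decide)

theorem impossible_of_mem_reducedSet_neg_thirty_five :
    ∀ e ∈ reducedSet (-35), e.Impossible := by
  rintro ⟨kind, δ₁, δ₂⟩ ⟨hpos, h⟩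
  have factors : δ₁ * δ₂ = 35 → (δ₁ = 35 ∧ δ₂ = 1) ∨ (δ₁ = 7 ∧ δ₂ = 5) ∨ (δ₁ = 5 ∧ δ₂ = 7) ∨
      (δ₁ = 1 ∧ δ₂ = 35) := by
    intro h
    have hle := Int.le_of_dvd (by norm_num) (Dvd.intro_left _ h)
    interval_cases δ₂ <;> omega
  rcases kind with _ | _ | _ | _
  · rcases factors h.2 with ⟨rfl, rfl⟩ | ⟨rfl, rfl⟩ | ⟨rfl, rfl⟩ | ⟨rfl, rfl⟩ <;>
      exact impossible_I_of_add_emod_eight (by norm_num) (by norm_num)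
  · rcases factors h.2 with ⟨rfl, rfl⟩ | h
    · apply impossible_II_one (by norm_num)
      · intro f hf hfc h
        have hle := Int.le_of_dvd (by norm_num) hfc
        interval_cases f <;> omega
      · intro f hf hfc h
        have hle := Int.le_of_dvd (by norm_num) hfc
        interval_cases f <;> omega
      · intro x y p _ _ _ heq
        have := pow_three_emod_nine x
        have := pow_six_emod_nine y
        have := pow_six_emod_nine p
        omega
    · rcases h with ⟨rfl, rfl⟩ | ⟨rfl, rfl⟩ | ⟨rfl, rfl⟩ <;>
        refine impossible_II_of_dvd 7 (by norm_num) (by norm_num) fun x y₁ y₂ heq => ?_ <;>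
        · have := pow_three_emod_seven x
          have := pow_six_emod_seven y₁
          have := pow_six_emod_seven y₂
          omega
  · exact absurd h.1 (by decide)
  · exact absurd h.1 (by decide)

theorem impossible_of_mem_reducedSet_neg_twenty_one :
    ∀ e ∈ reducedSet (-21), e.Impossible := by
  rintro ⟨kind, δ₁, δ₂⟩ ⟨hpos, h⟩
  have factors : δ₁ * δ₂ = 21 → (δ₁ = 21 ∧ δ₂ = 1) ∨ (δ₁ = 3 ∧ δ₂ = 7) ∨ (δ₁ = 7 ∧ δ₂ = 3) ∨
      (δ₁ = 1 ∧ δ₂ = 21) := by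
    intro h
    have hle := Int.le_of_dvd (by norm_num) (Dvd.intro_left _ h)
    interval_cases δ₂ <;> omega
  rcases kind with _ | _ | _ | _
  · rcases factors h.2 with ⟨rfl, rfl⟩ | ⟨rfl, rfl⟩ | ⟨rfl, rfl⟩ | ⟨rfl, rfl⟩ <;>
      refine impossible_I_of_dvd 7 (by norm_num) (by norm_num) fun x y₁ y₂ heq => ?_ <;>
      · have := pow_three_emod_seven x
        have := pow_six_emod_seven y₁
        have := pow_six_emod_seven y₂
        omega
  · rcases factors h.2 with ⟨rfl, rfl⟩ | ⟨rfl, rfl⟩ | h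
    · apply impossible_II_one (by norm_num)
      · intro f hf hfc h
        have hle := Int.le_of_dvd (by norm_num) hfc
        interval_cases f <;> omega
      · intro f hf hfc h
        have hle := Int.le_of_dvd (by norm_num) hfc
        interval_cases f <;> omega
      · intro x y p _ _ _ heq
        have := pow_three_emod_nine x
        have := pow_six_emod_nine y
        have := pow_six_emod_nine p
        omega
    · refine impossible_II_of_dvd 13 (by norm_num) (by norm_num) fun x y₁ y₂ heq => ?_
      have hx := pow_three_emod_thirteen x
      rcases pow_six_emod_thirteen y₁ with h₁ | h₁ | h₁ <;>
        rcases pow_six_emod_thirteen y₂ with h₂ | h₂ | h₂ <;> omega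
    · rcases h with ⟨rfl, rfl⟩ | ⟨rfl, rfl⟩ <;>
        refine impossible_II_of_dvd 7 (by norm_num) (by norm_num) fun x y₁ y₂ heq => ?_ <;>
        · have := pow_three_emod_seven x
          have := pow_six_emod_seven y₁
          have := pow_six_emod_seven y₂
          omega
  · exact absurd h.1 (by decide)
  · exact absurd h.1 (by decide)

theorem impossible_of_mem_reducedSet_thirty_one :
    ∀ e ∈ reducedSet 31, e.Impossible := by
  rintro ⟨kind, δ₁, δ₂⟩ ⟨hpos, h⟩
  have factors : δ₁ * δ₂ = -31 → (δ₁ = -31 ∧ δ₂ = 1) ∨ (δ₁ = -1 ∧ δ₂ = 31) := by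
    intro h
    have hle : δ₂ ≤ 31 := Int.le_of_dvd (by norm_num) ⟨-δ₁, by linarith⟩
    interval_cases δ₂ <;> omega
  rcases kind with _ | _ | _ | _
  · rcases factors h.2 with ⟨rfl, rfl⟩ | ⟨rfl, rfl⟩ <;>
      refine impossible_I_of_dvd 3 Int.prime_three (by norm_num) fun x y₁ y₂ heq => ?_ <;>
      · have := pow_three_emod_nine x
        have := pow_six_emod_nine y₁
        have := pow_six_emod_nine y₂
        omega
  · rcases factors h.2 with ⟨rfl, rfl⟩ | ⟨rfl, rfl⟩
    · apply impossible_II_one (by norm_num)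
      · intro f hf hfc h
        have hle := Int.le_of_dvd (by norm_num) ((dvd_neg (α := ℤ)).mp hfc)
        interval_cases f <;> omega
      · intro f hf hfc h
        have hle := Int.le_of_dvd (by norm_num) ((dvd_neg (α := ℤ)).mp hfc)
        interval_cases f <;> omega
      · intro x y p hx2 hp2 hxp heq
        by_contra hy3
        exact no_solution_of_not_three_dvd hx2 hp2 hxp hy3 heq
    · refine impossible_II_of_dvd 3 Int.prime_three (by norm_num) fun x y₁ y₂ heq => ?_
      have := pow_three_emod_nine x
      have := pow_six_emod_nine y₁
      have := pow_six_emod_nine y₂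
      omega
  · exact absurd h.1 (by decide)
  · exact absurd h.1 (by decide)

theorem impossible_of_mem_reducedSet_neg_nine_hundred_seventy_two :
    ∀ e ∈ reducedSet (-972), e.Impossible := by
  rintro ⟨kind, δ₁, δ₂⟩ ⟨hpos, h⟩
  rcases kind with _ | _ | _ | _
  · exact absurd h.1 (by decide)
  · exact absurd h.1 (by decide)
  · have h243 : δ₁ * δ₂ = 243 := by linarith [h.2]
    have factors : (δ₁ = 1 ∧ δ₂ = 243) ∨ (δ₁ = 243 ∧ δ₂ = 1) ∨ (δ₁ = 3 ∧ δ₂ = 81) ∨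
        (δ₁ = 9 ∧ δ₂ = 27) ∨ (δ₁ = 27 ∧ δ₂ = 9) ∨ (δ₁ = 81 ∧ δ₂ = 3) := by
      clear h
      have hle := Int.le_of_dvd (by norm_num) (Dvd.intro_left _ h243)
      interval_cases δ₂ <;> omega
    clear h h243 hpos
    rcases factors with ⟨rfl, rfl⟩ | ⟨rfl, rfl⟩ | h
    · intro x y₁ y₂ hsol
      rw [Equation.isSolution_III_iff (by norm_num)] at hsol
      obtain ⟨h0, heq, hcop, hx⟩ := hsol
      rw [one_mul] at heq hcop
      exact no_solution_two_hundred_forty_three (right_ne_zero_of_mul h0) hcop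
        hx.of_mul_right_left heq
    · intro x y₁ y₂ hsol
      rw [Equation.isSolution_III_iff (by norm_num)] at hsol
      obtain ⟨h0, heq, hcop, hx⟩ := hsol
      rw [one_mul] at heq hcop
      exact no_solution_two_hundred_forty_three (left_ne_zero_of_mul h0) hcop.symm
        hx.of_mul_right_right (by rw [heq, add_comm])
    · rcases h with ⟨rfl, rfl⟩ | ⟨rfl, rfl⟩ | ⟨rfl, rfl⟩ | ⟨rfl, rfl⟩ <;>
        refine impossible_III_of_dvd fun x y₁ y₂ heq => ?_ <;>
        obtain ⟨m, rfl⟩ : 3 ∣ x := Int.prime_three.dvd_of_dvd_pow (n := 3) (by omega) <;>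
        refine ⟨dvd_mul_right .., ?_⟩ <;>
        have hm : (3 * m) ^ 3 = 27 * m ^ 3 := by ring
      · exact dvd_mul_of_dvd_left (Int.prime_three.dvd_of_dvd_pow (n := 6) (by omega)) _
      · exact dvd_mul_of_dvd_left (Int.prime_three.dvd_of_dvd_pow (n := 6) (by omega)) _
      · exact dvd_mul_of_dvd_right (Int.prime_three.dvd_of_dvd_pow (n := 6) (by omega)) _
      · exact dvd_mul_of_dvd_right (Int.prime_three.dvd_of_dvd_pow (n := 6) (by omega)) _
  · exact absurd h.1 (by decide)

/-! ### From rational points to the reduced set -/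

theorem exists_int_of_mem_finitePoints {k : ℤ} {P : ℚ × ℚ} (hP : P ∈ finitePoints k) :
    ∃ x y z : ℤ, y ≠ 0 ∧ IsCoprime x y ∧ z ^ 2 = x ^ 6 + k * y ^ 6 := by
  have hP' : P.2 ^ 2 = P.1 ^ 6 + (k : ℚ) := hP
  have hden : (P.1.den : ℚ) ≠ 0 := by exact_mod_cast P.1.den_ne_zero
  have hsq : IsSquare ((P.1.num ^ 6 + k * (P.1.den : ℤ) ^ 6 : ℤ) : ℚ) := by
    refine ⟨P.2 * P.1.den ^ 3, ?_⟩
    have hnum : (P.1.num : ℚ) = P.1 * P.1.den := (Rat.mul_den_eq_num P.1).symm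
    push_cast
    rw [hnum]
    linear_combination (-(P.1.den : ℚ) ^ 6) * hP'
  obtain ⟨z, hz⟩ := Rat.isSquare_intCast_iff.mp hsq
  exact ⟨P.1.num, P.1.den, z, by exact_mod_cast P.1.den_ne_zero, P.1.isCoprime_num_den,
    by rw [sq, ← hz]⟩

/-- A coprime pair `(δ₁, δ₂)` with a solution yields a solution for `(δ₁, δ₂)` or `(-δ₁, -δ₂)`,
whichever belongs to the reduced set, because the left sides of the equations are odd in `x`. -/
theorem not_isSolution_of_forall_impossible {k δ₁ δ₂ x y₁ y₂ : ℤ} {kind : Kind}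
    (hk : ∀ e ∈ reducedSet k, e.Impossible) (hkind : kind ≠ .IV) (hδ : Int.gcd δ₁ δ₂ = 1)
    (hδ₂ : δ₂ ≠ 0)
    (hmem : ∀ ε : ℤ, ε * ε = 1 → 0 < ε * δ₂ → Equation.mk kind (ε * δ₁) (ε * δ₂) ∈ reducedSet k) :
    ¬ (Equation.mk kind δ₁ δ₂).IsSolution x y₁ y₂ := by
  intro h
  rcases lt_or_gt_of_ne hδ₂ with hneg | hpos
  · have hmem' := hmem (-1) (by norm_num) (by omega)
    rw [neg_one_mul, neg_one_mul] at hmem'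
    refine hk _ hmem' (-x) y₁ y₂ ?_
    have hδ' : Int.gcd (-δ₁) (-δ₂) = 1 := by simpa using hδ
    rcases kind with _ | _ | _ | _
    · rw [Equation.isSolution_I_iff hδ] at h
      rw [Equation.isSolution_I_iff hδ']
      obtain ⟨h0, heq, hcop, hx⟩ := h
      refine ⟨h0, by linear_combination -heq, ?_, ?_⟩
      · simpa only [neg_mul, IsCoprime.neg_left_iff, IsCoprime.neg_right_iff] using hcop
      · simpa only [mul_neg, IsCoprime.neg_left_iff] using hx
    · rw [Equation.isSolution_II_iff hδ] at h
      rw [Equation.isSolution_II_iff hδ']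
      obtain ⟨h0, heq, hcop, hx⟩ := h
      refine ⟨h0, by linear_combination -heq, ?_, ?_⟩
      · simpa only [mul_neg, neg_mul, IsCoprime.neg_left_iff, IsCoprime.neg_right_iff] using hcop
      · simpa only [IsCoprime.neg_left_iff] using hx
    · rw [Equation.isSolution_III_iff hδ] at h
      rw [Equation.isSolution_III_iff hδ']
      obtain ⟨h0, heq, hcop, hx⟩ := h
      refine ⟨h0, by linear_combination -heq, ?_, ?_⟩
      · simpa only [neg_mul, IsCoprime.neg_left_iff, IsCoprime.neg_right_iff] using hcop
      · simpa only [IsCoprime.neg_left_iff] using hx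
    · exact (hkind rfl).elim
  · have hmem' := hmem 1 (by norm_num) (by omega)
    rw [one_mul, one_mul] at hmem'
    exact hk _ hmem' x y₁ y₂ h

theorem isCoprime_mul_of_isCoprime_mul_pow {e f a b : ℤ} (h : IsCoprime (e * a ^ 6) (f * b ^ 6)) :
    IsCoprime (e * a) (f * b) :=
  (h.of_isCoprime_of_dvd_left (mul_dvd_mul_left e (dvd_pow_self a (by norm_num))))
    |>.of_isCoprime_of_dvd_right (mul_dvd_mul_left f (dvd_pow_self b (by norm_num)))

theorem isCoprime_of_squarefree {k x y z : ℤ} (hk : Squarefree k) (hxy : IsCoprime x y)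
    (h : z ^ 2 = x ^ 6 + k * y ^ 6) : IsCoprime x z :=
  isCoprime_of_no_common_prime fun q hq hqx hqz => hq.not_isUnit <| hk q <| by
    have h1 : q ^ 2 ∣ k * y ^ 6 := by
      have h2 : k * y ^ 6 = z ^ 2 - x ^ 2 * x ^ 4 := by rw [h]; ring
      exact h2 ▸ dvd_sub (pow_dvd_pow_of_dvd hqz 2)
        (dvd_mul_of_dvd_left (pow_dvd_pow_of_dvd hqx 2) _)
    rw [← sq]
    have hqy : IsCoprime q y := hxy.of_isCoprime_of_dvd_left hqx
    exact (hqy.pow (m := 2) (n := 6)).dvd_of_dvd_mul_right h1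

theorem mk_II_mem_reducedSet {k δ₁ δ₂ ε : ℤ} (hk2 : k % 2 = 1) (h : δ₁ * δ₂ = -k)
    (hε : ε * ε = 1) (hpos : 0 < ε * δ₂) : Equation.mk .II (ε * δ₁) (ε * δ₂) ∈ reducedSet k :=
  ⟨hpos, hk2, by linear_combination (ε * ε) * h - k * hε⟩

/-- For `k` odd and squarefree a rational point of the curve gives a solution of an equation of
type I or II, by factoring `(z - x ^ 3) * (z + x ^ 3) = k * y ^ 6`. -/
theorem finitePoints_eq_empty_of_squarefree {k : ℤ} (hk2 : k % 2 = 1) (hsq : Squarefree k)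
    (hk : ∀ e ∈ reducedSet k, e.Impossible) : finitePoints k = ∅ := by
  rw [Set.eq_empty_iff_forall_notMem]
  intro P hP
  obtain ⟨x, y, z, hy, hxy, hz⟩ := exists_int_of_mem_finitePoints hP
  have hxz := isCoprime_of_squarefree hsq hxy hz
  have hk0 : k ≠ 0 := by omega
  have hprod : (z - x ^ 3) * (z + x ^ 3) = k * y ^ 6 := by linear_combination hz
  rcases Int.emod_two_eq_zero_or_one (z - x ^ 3) with hpar | hpar
  · obtain ⟨r, hr⟩ : 2 ∣ z - x ^ 3 := by omega
    obtain ⟨s, hs⟩ : 2 ∣ z + x ^ 3 := by omega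
    have hsr : s - r = x ^ 3 := by omega
    have hrs : r + s = z := by omega
    have hcop : IsCoprime r s := isCoprime_of_no_common_prime fun q hq hqr hqs =>
      not_dvd_of_isCoprime hq hxz (hq.dvd_of_dvd_pow (n := 3) (hsr ▸ dvd_sub hqs hqr))
        (hrs ▸ dvd_add hqr hqs)
    have hx2 : x % 2 = 1 := by
      by_contra hx2
      have h1 : 2 ∣ x := by omega
      have h2 : 2 ∣ x ^ 3 := dvd_pow h1 (by norm_num)
      exact not_dvd_of_isCoprime Int.prime_two hxz h1 (by omega)
    obtain ⟨w, rfl⟩ : 2 ∣ y := by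
      have h2 : 2 ∣ k * y ^ 6 := ⟨r * (z + x ^ 3), by rw [← hprod, hr]; ring⟩
      refine Int.prime_two.dvd_of_dvd_pow ((Int.prime_two.dvd_or_dvd h2).resolve_left ?_)
      omega
    have hrs' : r * s = (16 * k) * w ^ 6 := by
      rw [hr, hs] at hprod
      exact mul_left_cancel₀ (by norm_num : (4 : ℤ) ≠ 0) (by linear_combination hprod)
    have hxw : IsCoprime x w := hxy.of_mul_right_right
    obtain ⟨e, f, a, b, hef, hab, hre, hsf⟩ := exists_mul_pow_six_of_isCoprime
      (mul_ne_zero (by norm_num) hk0) (by rintro rfl; simp at hy) hcop hrs'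
    have hcop' : IsCoprime (e * a) (f * b) := isCoprime_mul_of_isCoprime_mul_pow (hre ▸ hsf ▸ hcop)
    have hef' : IsCoprime e f := hcop'.of_mul_left_left.of_mul_right_left
    have hab0 : a * b ≠ 0 := by rw [hab]; rintro rfl; simp at hy
    -- `16` divides one of the coprime factors `e` and `f`.
    rcases Int.emod_two_eq_zero_or_one f with hf2 | hf2
    · have he2 : e % 2 = 1 := by
        by_contra he2
        exact not_dvd_of_isCoprime Int.prime_two hef' (by omega) (by omega)
      obtain ⟨f, rfl⟩ : 16 ∣ f :=
        (isCoprime_two_pow_of_odd 4 he2).dvd_of_dvd_mul_left ⟨k, hef⟩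
      have hcop2 : IsCoprime (2 * f * b) (-e * a) := by
        rw [neg_mul, IsCoprime.neg_right_iff]
        exact hcop'.symm.of_isCoprime_of_dvd_left ⟨8, by ring⟩
      have hδ : Int.gcd f (-e) = 1 := Int.isCoprime_iff_gcd_eq_one.mp
        hcop2.of_mul_left_left.of_mul_left_right.of_mul_right_left
      refine not_isSolution_of_forall_impossible (kind := .II) (x := x) (y₁ := b) (y₂ := a) hk
        (by simp) hδ (by omega)
        (fun ε => mk_II_mem_reducedSet hk2 (by linarith)) ?_
      rw [Equation.isSolution_II_iff hδ]
      refine ⟨by rwa [mul_comm], by rw [← hsr, hre, hsf]; ring, hcop2, ?_⟩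
      rw [mul_assoc, mul_comm b, hab]
      exact hxy
    · obtain ⟨e, rfl⟩ : 16 ∣ e :=
        (isCoprime_two_pow_of_odd 4 hf2).dvd_of_dvd_mul_right ⟨k, hef⟩
      have hcop2 : IsCoprime (2 * -e * a) (f * b) := by
        rw [mul_neg, neg_mul, IsCoprime.neg_left_iff]
        exact hcop'.of_isCoprime_of_dvd_left ⟨8, by ring⟩
      have hδ : Int.gcd (-e) f = 1 := Int.isCoprime_iff_gcd_eq_one.mp
        hcop2.of_mul_left_left.of_mul_left_right.of_mul_right_left
      refine not_isSolution_of_forall_impossible (kind := .II) (x := x) (y₁ := a) (y₂ := b) hk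
        (by simp) hδ (by omega)
        (fun ε => mk_II_mem_reducedSet hk2 (by linarith)) ?_
      rw [Equation.isSolution_II_iff hδ]
      refine ⟨hab0, by rw [← hsr, hre, hsf]; ring, hcop2, ?_⟩
      rw [mul_assoc, hab]
      exact hxy
  · have hcop : IsCoprime (z - x ^ 3) (z + x ^ 3) :=
      isCoprime_of_no_common_prime fun q hq hqr hqs => by
        have hq2 : ¬ q ∣ 2 := fun h => by
          have : (2 : ℤ) ∣ q := (hq.associated_of_dvd Int.prime_two h).symm.dvd
          have := this.trans hqr
          omega
        have h1 : q ∣ 2 * x ^ 3 := by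
          have : 2 * x ^ 3 = (z + x ^ 3) - (z - x ^ 3) := by ring
          exact this ▸ dvd_sub hqs hqr
        have h2 : q ∣ 2 * z := by
          have : 2 * z = (z + x ^ 3) + (z - x ^ 3) := by ring
          exact this ▸ dvd_add hqs hqr
        exact not_dvd_of_isCoprime hq hxz
          (hq.dvd_of_dvd_pow ((hq.dvd_or_dvd h1).resolve_left hq2))
          ((hq.dvd_or_dvd h2).resolve_left hq2)
    have hy2 : ¬ 2 ∣ y := fun h => by
      have h1 : 2 ∣ (z - x ^ 3) * (z + x ^ 3) :=
        hprod ▸ dvd_mul_of_dvd_right (dvd_pow h (by norm_num)) _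
      rcases Int.prime_two.dvd_or_dvd h1 with h | h <;> omega
    obtain ⟨e, f, a, b, hef, hab, hre, hsf⟩ := exists_mul_pow_six_of_isCoprime hk0 hy hcop hprod
    have hcop' : IsCoprime (-e * a) (f * b) := by
      rw [neg_mul, IsCoprime.neg_left_iff]
      exact isCoprime_mul_of_isCoprime_mul_pow (hre ▸ hsf ▸ hcop)
    have hδ : Int.gcd (-e) f = 1 := Int.isCoprime_iff_gcd_eq_one.mp
      hcop'.of_mul_left_left.of_mul_right_left
    refine not_isSolution_of_forall_impossible (kind := .I) (x := x) (y₁ := a) (y₂ := b) hk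
      (by simp) hδ (by rintro rfl; exact hk0 (by rw [← hef, mul_zero]))
      (fun ε hε hpos => ⟨hpos, hk2, by linear_combination (-ε * ε) * hef - k * hε⟩) ?_
    rw [Equation.isSolution_I_iff hδ]
    refine ⟨by rwa [hab], by linear_combination hsf - hre, hcop', ?_⟩
    rw [hab]
    exact ((Int.prime_two.coprime_iff_not_dvd).mpr hy2).mul_left hxy

/-- The case `k = -972`, where the conditions at `2` and `3` have to be checked by hand. -/
theorem finitePoints_neg_nine_hundred_seventy_two
    (hk : ∀ e ∈ reducedSet (-972), e.Impossible) : finitePoints (-972) = ∅ := by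
  rw [Set.eq_empty_iff_forall_notMem]
  intro P hP
  obtain ⟨x, y, z, hy, hxy, hz⟩ := exists_int_of_mem_finitePoints hP
  have hx2 : x % 2 = 1 := by
    by_contra hx2
    obtain ⟨m, rfl⟩ : 2 ∣ x := by omega
    have hy2 : ¬ 2 ∣ y := not_dvd_of_isCoprime Int.prime_two hxy (dvd_mul_right ..)
    have hy8 := pow_six_emod_eight_of_odd (n := y) (by omega)
    have h1 : (2 * m) ^ 6 = 64 * m ^ 6 := by ring
    obtain ⟨w, rfl⟩ : 2 ∣ z := Int.prime_two.dvd_of_dvd_pow (n := 2) (by omega)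
    have h2 : (2 * w) ^ 2 = 4 * w ^ 2 := by ring
    have hw : ¬ 2 ∣ w := fun h => by
      have : 2 ∣ w ^ 2 := dvd_pow h two_ne_zero
      omega
    have := sq_emod_eight_of_odd (n := w) (by omega)
    omega
  have hx3 : ¬ 3 ∣ x := by
    rintro ⟨m, rfl⟩
    have hy3 : ¬ 3 ∣ y := not_dvd_of_isCoprime Int.prime_three hxy (dvd_mul_right ..)
    have hy9 := (pow_six_emod_nine y).resolve_left fun h => hy3 h.2
    have h1 : (3 * m) ^ 6 = 729 * m ^ 6 := by ring
    obtain ⟨w, rfl⟩ : 3 ∣ z := Int.prime_three.dvd_of_dvd_pow (n := 2) (by omega)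
    have h2 : (3 * w) ^ 2 = 9 * w ^ 2 := by ring
    obtain ⟨v, rfl⟩ : 3 ∣ w := Int.prime_three.dvd_of_dvd_pow (n := 2) (by omega)
    have h3 : (3 * v) ^ 2 = 9 * v ^ 2 := by ring
    obtain ⟨u, rfl⟩ : 3 ∣ v := Int.prime_three.dvd_of_dvd_pow (n := 2) (by omega)
    have h4 : (3 * u) ^ 2 = 9 * u ^ 2 := by ring
    omega
  have hx6 := pow_six_emod_eight_of_odd hx2
  have hz2 : z % 2 = 1 := by
    by_contra hz2
    have : 2 ∣ z ^ 2 := dvd_pow (by omega) two_ne_zero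
    omega
  have hx32 : x ^ 3 % 2 = 1 := by
    have := odd_mul (odd_mul hx2 hx2) hx2
    rwa [pow_succ, sq]
  obtain ⟨r, hr⟩ : 2 ∣ z - x ^ 3 := by omega
  obtain ⟨s, hs⟩ : 2 ∣ z + x ^ 3 := by omega
  have hsr : s - r = x ^ 3 := by omega
  have hrs : r * s = -243 * y ^ 6 := by
    have h1 : (2 * r) * (2 * s) = z ^ 2 - x ^ 6 := by rw [← hr, ← hs]; ring
    exact mul_left_cancel₀ (by norm_num : (4 : ℤ) ≠ 0) (by linear_combination h1 + hz)
  have hcop : IsCoprime r s := isCoprime_of_no_common_prime fun q hq hqr hqs => by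
    have hqx : q ∣ x := hq.dvd_of_dvd_pow (n := 3) (hsr ▸ dvd_sub hqs hqr)
    have h1 : q ∣ -243 * y ^ 6 := hrs ▸ dvd_mul_of_dvd_left hqr s
    rcases hq.dvd_or_dvd h1 with h | h
    · have h3 : q ∣ 3 ^ 5 := by
        have := (dvd_neg (α := ℤ)).mpr h
        norm_num at this ⊢
        exact this
      have : (3 : ℤ) ∣ q :=
        (hq.associated_of_dvd Int.prime_three (hq.dvd_of_dvd_pow h3)).symm.dvd
      exact hx3 (this.trans hqx)
    · exact not_dvd_of_isCoprime hq hxy hqx (hq.dvd_of_dvd_pow h)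
  obtain ⟨e, f, a, b, hef, hab, hre, hsf⟩ :=
    exists_mul_pow_six_of_isCoprime (by norm_num) hy hcop hrs
  have hcop' : IsCoprime (-e * a) (f * b) := by
    rw [neg_mul, IsCoprime.neg_left_iff]
    exact isCoprime_mul_of_isCoprime_mul_pow (hre ▸ hsf ▸ hcop)
  have hδ : Int.gcd (-e) f = 1 := Int.isCoprime_iff_gcd_eq_one.mp
    hcop'.of_mul_left_left.of_mul_right_left
  refine not_isSolution_of_forall_impossible (kind := .III) (x := x) (y₁ := a) (y₂ := b) hk
    (by simp) hδ (by rintro rfl; simp at hef)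
    (fun ε hε hpos => ⟨hpos, by decide, by linear_combination (-4 * ε * ε) * hef + 972 * hε⟩) ?_
  rw [Equation.isSolution_III_iff hδ]
  exact ⟨by rwa [hab], by linear_combination -hsr + hsf - hre, hcop', by rwa [hab]⟩

end Sextic

theorem mainTheorem8 (k : ℤ) (hk : k ∈ ({-43, -35, -21, 31, -972} : Set ℤ)) :
    (∀ e ∈ Sextic.reducedSet k, e.Impossible) ∧ Sextic.finitePoints k = ∅ := by
  rcases hk with rfl | rfl | rfl | rfl | rfl
  · have h := Sextic.impossible_of_mem_reducedSet_neg_forty_three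
    exact ⟨h, Sextic.finitePoints_eq_empty_of_squarefree (by norm_num)
      (Int.squarefree_natAbs.mp (Nat.Prime.prime (by norm_num)).squarefree) h⟩
  · have h := Sextic.impossible_of_mem_reducedSet_neg_thirty_five
    exact ⟨h, Sextic.finitePoints_eq_empty_of_squarefree (by norm_num)
      (Int.squarefree_natAbs.mp ((Nat.squarefree_mul (m := 5) (n := 7) (by norm_num)).mpr
        ⟨(Nat.Prime.prime (by norm_num)).squarefree,
          (Nat.Prime.prime (by norm_num)).squarefree⟩)) h⟩
  · have h := Sextic.impossible_of_mem_reducedSet_neg_twenty_one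
    exact ⟨h, Sextic.finitePoints_eq_empty_of_squarefree (by norm_num)
      (Int.squarefree_natAbs.mp ((Nat.squarefree_mul (m := 3) (n := 7) (by norm_num)).mpr
        ⟨(Nat.Prime.prime (by norm_num)).squarefree,
          (Nat.Prime.prime (by norm_num)).squarefree⟩)) h⟩
  · have h := Sextic.impossible_of_mem_reducedSet_thirty_one
    exact ⟨h, Sextic.finitePoints_eq_empty_of_squarefree (by norm_num)
      (Int.squarefree_natAbs.mp (Nat.Prime.prime (by norm_num)).squarefree) h⟩
  · have h := Sextic.impossible_of_mem_reducedSet_neg_nine_hundred_seventy_two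
    exact ⟨h, Sextic.finitePoints_neg_nine_hundred_seventy_two h⟩
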